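/- Let $L$ be a finite-dimensional complex solvable Lie algebra acting by right continuous operators on a complex Banach space $E$: each $x\in L$ acts as a bounded operator $e\mapsto ex$, linearly in $x$, with $e[x,y]=(ex)y-(ey)x$. For a linear functional $f$ on $L$ vanishing on $L^2=[L,L]$, let $d(f)$ be the differential on $E\otimes\bigwedge L$ given by $$d_p(f)\,e\langle x_1\wedge\dots\wedge x_p\rangle=\sum_{k=1}^{p}(-1)^{k+1}e(x_k-f(x_k))\langle x_1\wedge\dots\widehat{x_k}\dots\wedge x_p\rangle+\sum_{1\le k<l\le p}(-1)^{k+l}e\langle[x_k,x_l]\wedge x_1\wedge\dots\widehat{x_k}\dots\widehat{x_l}\dots\wedge x_p\rangle$$ for $p\ge 1$, and $d_0(f)=0$. The joint spectrum $Sp(L,E)$ is the set of linear functionals $f$ on $L$ with $f(L^2)=0$ and $H_*(E\otimes\bigwedge L,d(f))\neq0$. Let $L'$ be the vector space $L$ with the opposite bracket $[x,y]'=[y,x]$; it acts by right continuous operators on the topological dual $E^*$ of $E$, $x$ acting as the adjoint operator $x^*$. Proposition 3.6. Let $n=\dim L$ and $k=\dim L^2$. There is a basis $x_1,\dots,x_n$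 of $L$ such that $[x_j,x_i]\in\operatorname{span}(x_1,\dots,x_i)$ for all $i<j$ and $x_1,\dots,x_k$ span $L^2$. For every such basis, let $L_i$ be the ideal generated by $x_1,\dots,x_i$ and let $\tilde\theta(x_i)$ be the restriction of $\operatorname{ad}(x_i)$, $\operatorname{ad}(x_i)(y)=[x_i,y]$, to $L_i$. Then $\operatorname{trace}\tilde\theta(x_i)=0$ for $1\le i\le k$ and, in coordinates with respect to the basis dual to $x_1,\dots,x_n$, $$Sp(L,E)+(0,\dots,0,\operatorname{trace}\tilde\theta(x_{k+1}),\dots,\operatorname{trace}\tilde\theta(x_n))=Sp(L',E^*).$$ -/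

import Mathlib

open scoped TensorProduct

namespace SolvableSpectrum

section Opposite

/-- The opposite Lie algebra `L'` of `L`: the same vector space, with bracket
`⁅x, y⁆' = -⁅x, y⁆ = ⁅y, x⁆`. -/
def OppositeLie (L : Type*) : Type _ := L

variable {L : Type*} [LieRing L]

instance : AddCommGroup (OppositeLie L) := inferInstanceAs (AddCommGroup L)

instance : Bracket (OppositeLie L) (OppositeLie L) :=
  ⟨fun x y => (⁅(show L from y), (show L from x)⁆ : L)⟩

instance : LieRing (OppositeLie L) where
  add_lie x y z := lie_add (show L from z) (show L from x) (show L from y)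
  lie_add x y z := add_lie (show L from y) (show L from z) (show L from x)
  lie_self x := lie_self (show L from x)
  leibniz_lie x y z := by
    have h : ∀ a b c : L, ⁅⁅c, b⁆, a⁆ = ⁅c, ⁅b, a⁆⁆ + ⁅⁅c, a⁆, b⁆ := by
      intro a b c
      rw [lie_lie c b a, ← lie_skew b ⁅c, a⁆, sub_neg_eq_add]
    exact h x y z

variable [LieAlgebra ℂ L]

instance : Module ℂ (OppositeLie L) := inferInstanceAs (Module ℂ L)

instance : LieAlgebra ℂ (OppositeLie L) where
  lie_smul c x y := smul_lie c (show L from y) (show L from x)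

/-- The identity map `L → L'`, as a linear equivalence. -/
def toOpposite (L : Type*) [LieRing L] [LieAlgebra ℂ L] : L ≃ₗ[ℂ] OppositeLie L :=
  LinearEquiv.refl ℂ L

theorem toOpposite_lie (x y : L) :
    ⁅toOpposite L x, toOpposite L y⁆ = toOpposite L ⁅y, x⁆ := rfl

end Opposite

section Complex

variable {L : Type*} [LieRing L] [LieAlgebra ℂ L]
variable {E : Type*} [NormedAddCommGroup E] [NormedSpace ℂ E]

/-- An action of `L` on `E` by right continuous operators: every `x : L` acts as a bounded operator
`e ↦ e x`, written `π.op x e`, linearly in `x`, with `e ⁅x, y⁆ = (e x) y - (e y) x`. In particular,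
a Lie subalgebra `L` of the algebra of bounded operators acting on the right of `E` (where the
product `x y` is "first `x`, then `y`") acts in this way through its inclusion. -/
structure RightAction (L : Type*) [LieRing L] [LieAlgebra ℂ L]
    (E : Type*) [NormedAddCommGroup E] [NormedSpace ℂ E] where
  op : L →ₗ[ℂ] (E →L[ℂ] E)
  op_lie : ∀ (x y : L) (e : E), op ⁅x, y⁆ e = op y (op x e) - op x (op y e)

/-- The derived ideal `L² = [L, L]`, as a subspace. -/
def derivedSubspace (L : Type*) [LieRing L] [LieAlgebra ℂ L] : Submodule ℂ L :=
  (⁅(⊤ : LieIdeal ℂ L), (⊤ : LieIdeal ℂ L)⁆ : LieIdeal ℂ L).toSubmodule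

/-- `x ↦ (z₁, …, z_p) ↦ (e ↦ e (x - f x) ⊗ z₁ ∧ ⋯ ∧ z_p)`. -/
noncomputable def actionMap (π : RightAction L E) (f : Module.Dual ℂ L) (p : ℕ) :
    L →ₗ[ℂ] L [⋀^Fin p]→ₗ[ℂ] (E →ₗ[ℂ] E ⊗[ℂ] ⋀[ℂ]^p L) where
  toFun x := (LinearMap.lcomp ℂ (E ⊗[ℂ] ⋀[ℂ]^p L)
      ((π.op x : E →ₗ[ℂ] E) - f x • LinearMap.id)).compAlternatingMap
    ((TensorProduct.mk ℂ E (⋀[ℂ]^p L)).flip.compAlternatingMap (exteriorPower.ιMulti ℂ p))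
  map_add' x y := by
    ext z e
    simp [add_smul]
    abel
  map_smul' c x := by
    ext z e
    simp [TensorProduct.smul_tmul', smul_sub, mul_smul]

/-- The part `∑ (-1)^{k+1} e (x_k - f x_k) ⟨x_1 ∧ ⋯ x̂_k ⋯ ∧ x_{p+1}⟩` of the differential, as an
alternating map in the `x_k`. -/
noncomputable def actionPart (π : RightAction L E) (f : Module.Dual ℂ L) (p : ℕ) :
    L [⋀^Fin (p + 1)]→ₗ[ℂ] (E →ₗ[ℂ] E ⊗[ℂ] ⋀[ℂ]^p L) :=
  AlternatingMap.alternatizeUncurryFin (actionMap π f p)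

/-- The part `∑_{k < l} (-1)^{k+l} ⟨⁅x_k, x_l⁆ ∧ x_1 ∧ ⋯ x̂_k ⋯ x̂_l ⋯ ∧ x_{p+1}⟩` of the
differential (see `bracketPart_succ_apply`). The factor `1/2` is there because the alternatization
runs over ordered pairs. -/
noncomputable def bracketPart (L : Type*) [LieRing L] [LieAlgebra ℂ L] :
    (p : ℕ) → L [⋀^Fin (p + 1)]→ₗ[ℂ] ⋀[ℂ]^p L
  | 0 => 0
  | q + 1 => AlternatingMap.alternatizeUncurryFin (AlternatingMap.alternatizeUncurryFinLM ∘ₗ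
      ((-(1 / 2) : ℂ) • LinearMap.compr₂ (LieModule.toEnd ℂ L L : L →ₗ[ℂ] L →ₗ[ℂ] L)
        (AlternatingMap.curryLeft (exteriorPower.ιMulti ℂ (q + 1)))))

/-- The differential `d_{p+1}(f) : E ⊗ ⋀^{p+1} L → E ⊗ ⋀^p L`
(see `differential_tmul` for its values on decomposable elements). -/
noncomputable def differential (π : RightAction L E) (f : Module.Dual ℂ L) (p : ℕ) :
    E ⊗[ℂ] ⋀[ℂ]^(p + 1) L →ₗ[ℂ] E ⊗[ℂ] ⋀[ℂ]^p L :=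
  TensorProduct.lift (exteriorPower.alternatingMapLinearEquiv (actionPart π f p)).flip +
    LinearMap.lTensor E (exteriorPower.alternatingMapLinearEquiv (bracketPart L p))

/-- Pairs `k < l` in `Fin (q + 2)` are encoded as `k = i.castSucc`, `l = j.succ` with `i ≤ j`. -/
theorem bracketPart_succ_apply (q : ℕ) (x : Fin (q + 2) → L) :
    bracketPart L (q + 1) x = ∑ i : Fin (q + 1), ∑ j ∈ Finset.Ici i,
      (-1 : ℂ) ^ ((i.castSucc : ℕ) + (j.succ : ℕ)) • exteriorPower.ιMulti ℂ (q + 1)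
        (Matrix.vecCons ⁅x i.castSucc, x j.succ⁆ (j.removeNth (i.castSucc.removeNth x))) := by
  rw [bracketPart, AlternatingMap.alternatizeUncurryFin_alternatizeUncurryFinLM_comp_apply]
  refine Finset.sum_congr rfl fun i _ => Finset.sum_congr rfl fun j _ => ?_
  have h : ∀ a b : L, ∀ z : Fin q → L,
      exteriorPower.ιMulti ℂ (q + 1) (Matrix.vecCons ⁅b, a⁆ z) =
        - exteriorPower.ιMulti ℂ (q + 1) (Matrix.vecCons ⁅a, b⁆ z) := by
    intro a b z
    rw [← lie_skew]
    exact congrArg (fun g : L [⋀^Fin q]→ₗ[ℂ] ⋀[ℂ]^(q + 1) L => g z)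
      (map_neg (AlternatingMap.curryLeft (exteriorPower.ιMulti ℂ (q + 1))) ⁅a, b⁆)
  simp only [LinearMap.smul_apply, LinearMap.compr₂_apply, AlternatingMap.smul_apply,
    AlternatingMap.curryLeft_apply_apply, LieHom.coe_toLinearMap, LieModule.toEnd_apply_apply,
    h (x i.castSucc) (x j.succ)]
  rw [← Int.cast_smul_eq_zsmul ℂ, smul_neg, sub_neg_eq_add, ← add_smul, smul_smul]
  congr 1
  simp [pow_add]
  ring

theorem differential_tmul (π : RightAction L E) (f : Module.Dual ℂ L) (p : ℕ) (e : E)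
    (x : Fin (p + 1) → L) :
    differential π f p (e ⊗ₜ exteriorPower.ιMulti ℂ (p + 1) x) =
      ∑ k : Fin (p + 1), (-1 : ℂ) ^ (k : ℕ) •
        ((π.op (x k) e - f (x k) • e) ⊗ₜ[ℂ] exteriorPower.ιMulti ℂ p (k.removeNth x)) +
      e ⊗ₜ[ℂ] bracketPart L p x := by
  simp only [differential, LinearMap.add_apply, TensorProduct.lift.tmul, LinearMap.flip_apply,
    exteriorPower.alternatingMapLinearEquiv_apply_ιMulti, LinearMap.lTensor_tmul, actionPart,
    AlternatingMap.alternatizeUncurryFin_apply, LinearMap.sum_apply]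
  congr 1
  refine Finset.sum_congr rfl fun k _ => ?_
  rw [LinearMap.smul_apply, ← Int.cast_smul_eq_zsmul ℂ]
  simp [actionMap, TensorProduct.sub_tmul, TensorProduct.smul_tmul']

/-- The kernel of `d_p(f)`, where `d_0(f) = 0`. -/
noncomputable def cycles (π : RightAction L E) (f : Module.Dual ℂ L) :
    (p : ℕ) → Submodule ℂ (E ⊗[ℂ] ⋀[ℂ]^p L)
  | 0 => ⊤
  | p + 1 => LinearMap.ker (differential π f p)

/-- The homology `H_p(E ⊗ ⋀ L, d(f)) = ker d_p(f) / range d_{p+1}(f)`. -/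
abbrev Homology (π : RightAction L E) (f : Module.Dual ℂ L) (p : ℕ) : Type _ :=
  cycles π f p ⧸ (LinearMap.range (differential π f p)).comap (cycles π f p).subtype

/-- The joint spectrum `Sp(L, E)`: the functionals `f` vanishing on `L²` for which the homology
of `(E ⊗ ⋀ L, d(f))` is not zero. -/
def Sp (π : RightAction L E) : Set (Module.Dual ℂ L) :=
  {f | f ∈ (derivedSubspace L).dualAnnihilator ∧ ∃ p : ℕ, Nontrivial (Homology π f p)}

/-- `Sp(L, E)` in terms of the basis of the dual space that is dual to the basis `b`. -/
noncomputable def spCoordinates {n : ℕ} (b : Module.Basis (Fin n) ℂ L)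
    (π : RightAction L E) : Set (Fin n → ℂ) :=
  b.dualBasis.equivFun '' Sp π

/-- The action of `L'` by right operators on the topological dual of `E`: `x` acts by the adjoint
`x^*`, that is `φ x = φ ∘ x`. -/
noncomputable def dualAction (π : RightAction L E) :
    RightAction (OppositeLie L) (StrongDual ℂ E) where
  op :=
    { toFun := fun x => ContinuousLinearMap.precomp ℂ (π.op ((toOpposite L).symm x))
      map_add' := by
        intro x y
        ext φ e
        simp
      map_smul' := by
        intro c x
        ext φ e
        simp }
  op_lie x y φ := by
    have h : (toOpposite L).symm ⁅x, y⁆ = ⁅(toOpposite L).symm y, (toOpposite L).symm x⁆ := rfl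
    ext e
    simp [h, π.op_lie]

theorem dualAction_apply (π : RightAction L E) (x : L) (φ : StrongDual ℂ E) (e : E) :
    (dualAction π).op (toOpposite L x) φ e = φ (π.op x e) := rfl

end Complex

section Bases

variable {L : Type*} [LieRing L] [LieAlgebra ℂ L] {n : ℕ}

/-- A triangular basis `x_1, …, x_n` of `L`, i.e. `⁅x_j, x_i⁆ ∈ span {x_1, …, x_i}` for `i < j`,
whose first `dim L²` vectors span `L²`. -/
structure IsAdaptedBasis (b : Module.Basis (Fin n) ℂ L) : Prop where
  triangular : ∀ i j : Fin n, i < j → ⁅b j, b i⁆ ∈ Submodule.span ℂ (b '' {h | h ≤ i})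
  span_derived : Submodule.span ℂ
    (b '' {h | (h : ℕ) < Module.finrank ℂ (derivedSubspace L)}) = derivedSubspace L

/-- The ideal `L_i` generated by `x_1, …, x_i`. -/
def flagIdeal (b : Module.Basis (Fin n) ℂ L) (i : Fin n) : LieIdeal ℂ L :=
  LieSubmodule.lieSpan ℂ L (b '' {h | h ≤ i})

/-- The trace of `θ̃(x_i)`, the restriction of `ad x_i` to the ideal `L_i`. -/
noncomputable def traceTheta (b : Module.Basis (Fin n) ℂ L) (i : Fin n) : ℂ :=
  LinearMap.trace ℂ (flagIdeal b i) (LieModule.toEnd ℂ L (flagIdeal b i) (b i))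

end Bases

end SolvableSpectrum

/-! The spectrum is compared through duality. A complex of Banach spaces is exact exactly when its
dual complex is (`exact_iff_dual_exact`, a consequence of the closed range theorem and Hahn–Banach).
A power of `E` stands in for `E ⊗ ⋀^p L`, so this applies to the complex defining the spectrum.

With n = dim L, the wedge product into the one-dimensional top power identifies the dual of `E ⊗ ⋀^p
L` with `E^* ⊗ ⋀^(n-p) L'`. What remains is to compute the transposed differential. The action terms
are contractions, and they cross the wedge pairing by integration by parts (`contr_mul_eq`). The
bracket term crosses too (`bracketOp_mul`), but leaves behind a contraction by the functional x ↦
trace (ad x). Its minus sign is that of the opposite bracket. So, up to sign, the transpose is the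
differential of the dual action, with f replaced by f + `traceAd` (`tensorPairing_differential`).
Hence f lies in the spectrum of `E` exactly when its shift lies in that of `E^*`
(`mem_Sp_iff_shiftDual_mem_Sp`).

In coordinates the shift is by trace (ad x_i). This equals the trace on L_i because ad x_i maps L
into L_i, and it vanishes for i ≤ k because commutators have trace zero. Lie's theorem provides the
adapted bases. -/

namespace SolvableSpectrum

/-! ### The closed range theorem and Hahn–Banach factorization. -/

section ClosedRange

open Filter Topology

variable {X Y Z : Type*} [NormedAddCommGroup X] [NormedSpace ℂ X] [CompleteSpace X]
  [NormedAddCommGroup Y] [NormedSpace ℂ Y] [CompleteSpace Y]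
  [NormedAddCommGroup Z] [NormedSpace ℂ Z]

/-- Successive approximation, as in the open mapping theorem: each correction halves the error, so
the corrections form an absolutely convergent series in `X` whose sum is an exact preimage. -/
theorem surjective_of_approx_preimage (T : X →L[ℂ] Z) {C : ℝ}
    (hC : ∀ y, ∃ x, ‖y - T x‖ ≤ 1 / 2 * ‖y‖ ∧ ‖x‖ ≤ C * ‖y‖) : Function.Surjective T := by
  choose g hg using hC
  intro y
  let h : Z → Z := fun y => y - T (g y)
  have hnle : ∀ n : ℕ, ‖h^[n] y‖ ≤ (1 / 2) ^ n * ‖y‖ := by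
    intro n
    induction n with
    | zero => simp
    | succ n IH =>
      rw [Function.iterate_succ_apply', pow_succ', mul_assoc]
      exact (hg _).1.trans (by gcongr)
  let u : ℕ → X := fun n => g (h^[n] y)
  have hu : ∀ n, ‖u n‖ ≤ |C| * ‖y‖ * (1 / 2) ^ n := by
    intro n
    calc ‖u n‖ ≤ C * ‖h^[n] y‖ := (hg _).2
      _ ≤ |C| * ‖h^[n] y‖ := by gcongr; exact le_abs_self C
      _ ≤ |C| * ((1 / 2) ^ n * ‖y‖) := by gcongr; exact hnle n
      _ = |C| * ‖y‖ * (1 / 2) ^ n := by ring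
  have su : Summable u := Summable.of_norm_bounded
    (Summable.mul_left _ (summable_geometric_of_lt_one (by norm_num) (by norm_num))) hu
  have hsum : ∀ n : ℕ, T (∑ i ∈ Finset.range n, u i) = y - h^[n] y := by
    intro n
    induction n with
    | zero => simp
    | succ n IH =>
      rw [Finset.sum_range_succ, map_add, IH, Function.iterate_succ_apply', sub_add]
  have h1 : Tendsto (fun n => T (∑ i ∈ Finset.range n, u i)) atTop (𝓝 (T (tsum u))) :=
    (T.continuous.tendsto _).comp su.hasSum.tendsto_sum_nat
  have h2 : Tendsto (fun n => h^[n] y) atTop (𝓝 0) := by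
    refine squeeze_zero_norm hnle ?_
    rw [← zero_mul ‖y‖]
    exact (tendsto_pow_atTop_nhds_zero_of_lt_one (by norm_num) (by norm_num)).mul
      tendsto_const_nhds
  have h3 : Tendsto (fun n => T (∑ i ∈ Finset.range n, u i)) atTop (𝓝 (y - 0)) := by
    simp only [hsum]
    exact tendsto_const_nhds.sub h2
  exact ⟨tsum u, by simpa using tendsto_nhds_unique h1 h3⟩

/-- A bounded operator is onto if its adjoint is bounded below. -/
theorem surjective_of_antilipschitz_precomp (T : X →L[ℂ] Z) {K : NNReal}
    (hK : AntilipschitzWith K (ContinuousLinearMap.precomp ℂ T :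
      StrongDual ℂ Z →L[ℂ] StrongDual ℂ X)) : Function.Surjective T := by
  have hK' : ∀ ψ : StrongDual ℂ Z, ‖ψ‖ ≤ K * ‖ψ.comp T‖ := fun ψ => by
    simpa using hK.le_mul_dist ψ 0
  refine surjective_of_approx_preimage T (C := K + 1) fun y => ?_
  rcases eq_or_ne y 0 with rfl | hy
  · exact ⟨0, by simp⟩
  have hy' : 0 < ‖y‖ := norm_pos_iff.2 hy
  have hr : 0 < ((K : ℝ) + 1) * ‖y‖ := by positivity
  -- Otherwise Hahn–Banach gives ψ whose real part is at most u on the image of the ball and exceeds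
  -- u at `y`. Boundedness below gives |ψ y| ≤ u K/(K+1) ≤ u, a contradiction. The `+ 1` keeps the
  -- radius positive when `K = 0`.
  have hmem : y ∈ closure (T '' Metric.closedBall 0 (((K : ℝ) + 1) * ‖y‖)) := by
    by_contra hn
    have hconv : Convex ℝ (closure (T '' Metric.closedBall 0 (((K : ℝ) + 1) * ‖y‖))) := by
      refine Convex.closure ?_
      exact (convex_closedBall (0 : X) _).linear_image
        (T.toLinearMap.restrictScalars ℝ)
    obtain ⟨ψ, u, hlt, hgt⟩ := RCLike.geometric_hahn_banach_closed_point (𝕜 := ℂ) hconv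
      isClosed_closure hn
    have hlt' : ∀ x ∈ Metric.closedBall (0 : X) (((K : ℝ) + 1) * ‖y‖), ‖ψ (T x)‖ ≤ u := by
      intro x hx
      -- Rotating `x` by a unit scalar turns the bound on real parts into a bound on norms.
      obtain ⟨c, hc, hcx⟩ := RCLike.exists_norm_eq_mul_self (ψ (T x))
      have := hlt (T (c • x)) (subset_closure ⟨c • x, by simpa [norm_smul, hc] using hx, rfl⟩)
      rw [map_smul, map_smul, smul_eq_mul, ← hcx] at this
      simpa using this.le
    have hu : 0 ≤ u := (norm_nonneg _).trans (hlt' 0 (by simpa using hr.le))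
    have h1 : ‖ψ.comp T‖ ≤ u / ((K + 1) * ‖y‖) :=
      ContinuousLinearMap.opNorm_bound_of_ball_bound hr u (ψ.comp T)
        (fun x hx => hlt' x hx)
    have h2 : RCLike.re (ψ y) ≤ ‖ψ‖ * ‖y‖ := (RCLike.re_le_norm _).trans (ψ.le_opNorm y)
    have h3 : ‖ψ‖ * ‖y‖ ≤ K * (u / ((K + 1) * ‖y‖)) * ‖y‖ := by
      gcongr
      exact (hK' ψ).trans (by gcongr)
    have h4 : K * (u / ((K + 1) * ‖y‖)) * ‖y‖ ≤ u := by
      have : (K : ℝ) * (u / ((K + 1) * ‖y‖)) * ‖y‖ = u * (K / (K + 1)) := by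
        field_simp
      rw [this]
      refine mul_le_of_le_one_right hu ?_
      rw [div_le_one (by positivity)]
      linarith
    linarith
  obtain ⟨z, ⟨x, hx, rfl⟩, hz⟩ := Metric.mem_closure_iff.1 hmem (1 / 2 * ‖y‖) (by positivity)
  exact ⟨x, by rw [← dist_eq_norm]; exact hz.le, by simpa using hx⟩

/-- The closed range theorem: a bounded operator has closed range if its adjoint does. -/
theorem isClosed_range_of_isClosed_range_precomp (T : X →L[ℂ] Y)
    (h : IsClosed (Set.range (ContinuousLinearMap.precomp ℂ T :
      StrongDual ℂ Y →L[ℂ] StrongDual ℂ X))) : IsClosed (Set.range T) := by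
  -- Corestricting to the closure `W` of the range makes the adjoint injective (dense range) without
  -- changing its range (Hahn–Banach extension). It is then bounded below, so `T` maps onto `W`.
  set W : Submodule ℂ Y := (LinearMap.range T.toLinearMap).topologicalClosure with hW
  have hTW : ∀ x, T x ∈ W := fun x =>
    Submodule.le_topologicalClosure _ (LinearMap.mem_range_self T.toLinearMap x)
  have : CompleteSpace W :=
    (Submodule.isClosed_topologicalClosure (LinearMap.range T.toLinearMap)).completeSpace_coe
  let S : X →L[ℂ] W := T.codRestrict W hTW
  have hdense : ∀ w : W, w ∈ closure (Set.range S) := by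
    intro w
    rw [closure_subtype, ← Set.range_comp]
    exact w.2
  have hinj : Function.Injective (ContinuousLinearMap.precomp ℂ S :
      StrongDual ℂ W →L[ℂ] StrongDual ℂ X) := by
    intro φ ψ hφψ
    have : (φ : W → ℂ) = ψ := by
      refine Continuous.ext_on (s := Set.range S) hdense φ.continuous ψ.continuous ?_
      rintro _ ⟨x, rfl⟩
      exact DFunLike.congr_fun hφψ x
    exact DFunLike.coe_injective this
  have hrange : Set.range (ContinuousLinearMap.precomp ℂ S :
      StrongDual ℂ W →L[ℂ] StrongDual ℂ X) = Set.range (ContinuousLinearMap.precomp ℂ T :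
      StrongDual ℂ Y →L[ℂ] StrongDual ℂ X) := by
    ext φ
    constructor
    · rintro ⟨ψ, rfl⟩
      obtain ⟨g, hg, -⟩ := exists_extension_norm_eq W ψ
      refine ⟨g, ?_⟩
      ext x
      exact hg (S x)
    · rintro ⟨ψ, rfl⟩
      exact ⟨ψ.comp W.subtypeL, rfl⟩
  rw [← hrange] at h
  obtain ⟨K, hK⟩ := ContinuousLinearMap.antilipschitz_of_injective_of_isClosed_range
    (𝕜 := ℂ) (E := StrongDual ℂ W) (F := StrongDual ℂ X) (ContinuousLinearMap.precomp ℂ S) hinj h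
  have hS := surjective_of_antilipschitz_precomp S hK
  have : Set.range T = W := by
    ext y
    constructor
    · rintro ⟨x, rfl⟩
      exact hTW x
    · intro hy
      obtain ⟨x, hx⟩ := hS ⟨y, hy⟩
      exact ⟨x, congrArg Subtype.val hx⟩
  rw [this]
  exact Submodule.isClosed_topologicalClosure _

/-- A functional that vanishes on the kernel of an operator with closed range factors through
the operator. -/
theorem exists_dual_comp_eq_of_ker_le (T : X →L[ℂ] Y) (h : IsClosed (Set.range T))
    (φ : StrongDual ℂ X) (hφ : ∀ x, T x = 0 → φ x = 0) : ∃ ψ : StrongDual ℂ Y, ψ.comp T = φ := by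
  set W : Submodule ℂ Y := LinearMap.range T.toLinearMap with hW
  have hWc : IsClosed (W : Set Y) := h
  have : CompleteSpace W := hWc.completeSpace_coe
  let S : X →L[ℂ] W := T.codRestrict W fun x => LinearMap.mem_range_self T.toLinearMap x
  have hS : Function.Surjective S := by
    rintro ⟨_, x, rfl⟩
    exact ⟨x, rfl⟩
  obtain ⟨C, -, hC⟩ := S.exists_preimage_norm_le hS
  have hwd : ∀ x x', S x = S x' → φ x = φ x' := by
    intro x x' hxx
    rw [← sub_eq_zero, ← map_sub]
    apply hφ
    rw [map_sub, sub_eq_zero]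
    exact congrArg Subtype.val hxx
  choose g hg hgn using hC
  let ψ₀ : W →ₗ[ℂ] ℂ :=
    { toFun := fun w => φ (g w)
      map_add' := fun w w' => by
        rw [← map_add]
        exact hwd _ _ (by rw [map_add, hg, hg, hg])
      map_smul' := fun c w => by
        rw [RingHom.id_apply, ← map_smul]
        exact hwd _ _ (by rw [map_smul, hg, hg]) }
  let ψ₁ : StrongDual ℂ W := ψ₀.mkContinuous (‖φ‖ * C) fun w => by
    rw [mul_assoc]
    exact (φ.le_opNorm _).trans (by gcongr; exact hgn w)
  obtain ⟨ψ, hψ, -⟩ := exists_extension_norm_eq W ψ₁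
  refine ⟨ψ, ?_⟩
  ext x
  exact (hψ (S x)).trans (hwd _ _ (hg _))

omit [CompleteSpace X] in
theorem exists_dual_ne_zero_of_notMem (W : Submodule ℂ X) (hW : IsClosed (W : Set X)) {x : X}
    (hx : x ∉ W) : ∃ φ : StrongDual ℂ X, φ x ≠ 0 ∧ ∀ w ∈ W, φ w = 0 := by
  have : W.mkQL x ≠ 0 := by
    simpa using hx
  obtain ⟨ψ, hψ⟩ := SeparatingDual.exists_ne_zero (R := ℂ) this
  refine ⟨ψ.comp W.mkQL, hψ, fun w hw => ?_⟩
  have : W.mkQL w = 0 := by simpa using hw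
  simp [this]

end ClosedRange

/-! ### Exactness of a Banach complex and of its dual. -/

section DualComplex

variable {X : ℕ → Type*} [∀ p, NormedAddCommGroup (X p)] [∀ p, NormedSpace ℂ (X p)]
  [∀ p, CompleteSpace (X p)] (d : ∀ p, X (p + 1) →L[ℂ] X p)

/-- A chain complex of Banach spaces is exact if and only if the dual complex is. -/
theorem exact_iff_dual_exact (hdd : ∀ p x, d p (d (p + 1) x) = 0) :
    ((∀ x, ∃ y, d 0 y = x) ∧ ∀ p x, d p x = 0 → ∃ y, d (p + 1) y = x) ↔
    ((∀ φ : StrongDual ℂ (X 0), φ.comp (d 0) = 0 → φ = 0) ∧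
      ∀ p, ∀ φ : StrongDual ℂ (X (p + 1)), φ.comp (d (p + 1)) = 0 →
        ∃ ψ : StrongDual ℂ (X p), ψ.comp (d p) = φ) := by
  constructor
  · rintro ⟨h0, h1⟩
    -- By exactness each range is the whole space or the kernel of a continuous operator.
    have hcl : ∀ p, IsClosed (Set.range (d p)) := by
      rintro (_ | p)
      · rw [Set.range_eq_univ.2 h0]
        exact isClosed_univ
      · have : Set.range (d (p + 1)) = (d p) ⁻¹' {0} := by
          ext x
          constructor
          · rintro ⟨y, rfl⟩
            exact hdd p y
          · exact h1 p x
        rw [this]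
        exact isClosed_singleton.preimage (d p).continuous
    refine ⟨fun φ hφ => ?_, fun p φ hφ => ?_⟩
    · ext x
      obtain ⟨y, rfl⟩ := h0 x
      exact DFunLike.congr_fun hφ y
    · refine exists_dual_comp_eq_of_ker_le _ (hcl p) φ fun x hx => ?_
      obtain ⟨y, rfl⟩ := h1 p x hx
      exact DFunLike.congr_fun hφ y
  · rintro ⟨h0, h1⟩
    -- Here exactness makes the ranges of the adjoints closed, and the closed range theorem carries
    -- this back to `d p`. A point outside a range is then detected by a functional killing that
    -- range, which dual exactness forces to vanish at the point.
    have hcl : ∀ p, IsClosed (Set.range (d p)) := by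
      intro p
      refine isClosed_range_of_isClosed_range_precomp _ ?_
      have : Set.range (ContinuousLinearMap.precomp ℂ (d p) :
          StrongDual ℂ (X p) →L[ℂ] StrongDual ℂ (X (p + 1))) =
          (ContinuousLinearMap.precomp ℂ (d (p + 1)) :
          StrongDual ℂ (X (p + 1)) →L[ℂ] StrongDual ℂ (X (p + 2))) ⁻¹' {0} := by
        ext φ
        constructor
        · rintro ⟨ψ, rfl⟩
          refine ContinuousLinearMap.ext fun x => ?_
          change ψ (d p (d (p + 1) x)) = 0
          rw [hdd, map_zero]
        · exact h1 p φ
      rw [this]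
      exact isClosed_singleton.preimage (ContinuousLinearMap.continuous _)
    constructor
    · intro x
      by_contra hx
      obtain ⟨φ, hφ, hφ'⟩ := exists_dual_ne_zero_of_notMem (LinearMap.range (d 0).toLinearMap)
        (hcl 0) (x := x) hx
      refine hφ ?_
      rw [h0 φ (ContinuousLinearMap.ext fun y => hφ' _ ⟨y, rfl⟩)]
      rfl
    · intro p x hpx
      by_contra hx
      obtain ⟨φ, hφ, hφ'⟩ := exists_dual_ne_zero_of_notMem
        (LinearMap.range (d (p + 1)).toLinearMap) (hcl (p + 1)) (x := x) hx
      obtain ⟨ψ, rfl⟩ := h1 p φ (ContinuousLinearMap.ext fun y => hφ' _ ⟨y, rfl⟩)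
      exact hφ (by simp [hpx])

end DualComplex

/-! ### Contractions and the wedge pairing on the exterior algebra. -/

section Contraction

variable {L : Type*} [AddCommGroup L] [Module ℂ L]

/-- Contraction of an element of the exterior algebra with a linear functional. -/
noncomputable def contr : Module.Dual ℂ L →ₗ[ℂ] ExteriorAlgebra ℂ L →ₗ[ℂ] ExteriorAlgebra ℂ L :=
  CliffordAlgebra.contractLeft (Q := (0 : QuadraticForm ℂ L))

/-- The grade involution of the exterior algebra. -/
noncomputable def gradeInv : ExteriorAlgebra ℂ L →ₐ[ℂ] ExteriorAlgebra ℂ L :=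
  CliffordAlgebra.involute (Q := (0 : QuadraticForm ℂ L))

variable (g h : Module.Dual ℂ L) (x : L) (v w : ExteriorAlgebra ℂ L)

theorem contr_ι_mul :
    contr g (ExteriorAlgebra.ι ℂ x * w) = g x • w - ExteriorAlgebra.ι ℂ x * contr g w :=
  CliffordAlgebra.contractLeft_ι_mul (Q := (0 : QuadraticForm ℂ L)) g x w

theorem contr_one : contr g (1 : ExteriorAlgebra ℂ L) = 0 :=
  CliffordAlgebra.contractLeft_one (Q := (0 : QuadraticForm ℂ L)) g

theorem contr_algebraMap (c : ℂ) : contr g (algebraMap ℂ (ExteriorAlgebra ℂ L) c) = 0 :=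
  CliffordAlgebra.contractLeft_algebraMap (Q := (0 : QuadraticForm ℂ L)) g c

theorem contr_comm : contr g (contr h w) = -contr h (contr g w) :=
  CliffordAlgebra.contractLeft_comm (Q := (0 : QuadraticForm ℂ L)) g h w

theorem gradeInv_ι : gradeInv (ExteriorAlgebra.ι ℂ x) = -ExteriorAlgebra.ι ℂ x :=
  CliffordAlgebra.involute_ι (Q := (0 : QuadraticForm ℂ L)) x

theorem exteriorAlgebra_induction {P : ExteriorAlgebra ℂ L → Prop}
    (hadd : ∀ a b, P a → P b → P (a + b)) (halg : ∀ c : ℂ, P (algebraMap ℂ _ c))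
    (hmul : ∀ (x : L) a, P a → P (ExteriorAlgebra.ι ℂ x * a)) : P w :=
  CliffordAlgebra.left_induction (Q := (0 : QuadraticForm ℂ L)) (P := P) halg hadd
    (fun a x ha => hmul x a ha) w

theorem contr_gradeInv : contr g (gradeInv w) = -gradeInv (contr g w) := by
  induction w using exteriorAlgebra_induction with
  | hadd a b ha hb => rw [map_add, map_add, map_add, map_add, ha, hb, neg_add]
  | halg c => rw [AlgHom.commutes, contr_algebraMap, map_zero, neg_zero]
  | hmul x a ha =>
    rw [map_mul, gradeInv_ι, neg_mul, map_neg, contr_ι_mul, contr_ι_mul, map_sub, map_mul,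
      gradeInv_ι, map_smul, ha]
    simp

theorem contr_mul : contr g (v * w) = contr g v * w + gradeInv v * contr g w := by
  induction v using exteriorAlgebra_induction with
  | hadd a b ha hb => rw [add_mul, map_add, map_add, map_add, ha, hb]; noncomm_ring
  | halg c =>
    rw [AlgHom.commutes, contr_algebraMap, ← Algebra.smul_def, ← Algebra.smul_def, map_smul,
      zero_mul, zero_add]
  | hmul x a ha =>
    rw [mul_assoc, contr_ι_mul, contr_ι_mul, ha, map_mul, gradeInv_ι, sub_mul, smul_mul_assoc]
    noncomm_ring

theorem ι_mul_eq : ExteriorAlgebra.ι ℂ x * w = gradeInv w * ExteriorAlgebra.ι ℂ x := by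
  induction w using exteriorAlgebra_induction with
  | hadd a b ha hb => rw [map_add, mul_add, add_mul, ha, hb]
  | halg c => rw [AlgHom.commutes, Algebra.commutes]
  | hmul y a ha =>
    have := ExteriorAlgebra.ι_add_mul_swap (R := ℂ) x y
    rw [map_mul, gradeInv_ι, mul_assoc, ← ha, ← mul_assoc, ← mul_assoc,
      eq_neg_of_add_eq_zero_left this, neg_mul, neg_mul, neg_mul]

theorem ιMulti_mem (p : ℕ) (x : Fin p → L) : ExteriorAlgebra.ιMulti ℂ p x ∈ ⋀[ℂ]^p L :=
  (exteriorPower.ιMulti ℂ p x).2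

theorem ιMulti_induction {p : ℕ} {P : (w : ExteriorAlgebra ℂ L) → w ∈ ⋀[ℂ]^p L → Prop}
    (hadd : ∀ a b ha hb, P a ha → P b hb → P (a + b) (add_mem ha hb))
    (hsmul : ∀ (c : ℂ) a ha, P a ha → P (c • a) (Submodule.smul_mem _ c ha))
    (hι : ∀ x : Fin p → L, P (ExteriorAlgebra.ιMulti ℂ p x) (ιMulti_mem p x))
    {w : ExteriorAlgebra ℂ L} (hw : w ∈ ⋀[ℂ]^p L) : P w hw := by
  have h := hw
  rw [← ExteriorAlgebra.ιMulti_span_fixedDegree] at h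
  induction h using Submodule.span_induction with
  | mem w hm => obtain ⟨x, rfl⟩ := hm; exact hι x
  | zero => simpa using hsmul 0 _ _ (hι 0)
  | add a b ha hb iha ihb =>
    rw [ExteriorAlgebra.ιMulti_span_fixedDegree] at ha hb
    exact hadd a b ha hb (iha ha) (ihb hb)
  | smul c a ha iha =>
    rw [ExteriorAlgebra.ιMulti_span_fixedDegree] at ha
    exact hsmul c a ha (iha ha)

theorem ιMulti_succ (p : ℕ) (x : Fin (p + 1) → L) : ExteriorAlgebra.ιMulti ℂ (p + 1) x =
    ExteriorAlgebra.ι ℂ (x 0) * ExteriorAlgebra.ιMulti ℂ p (Matrix.vecTail x) :=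
  ExteriorAlgebra.ιMulti_succ_apply x

theorem gradeInv_ιMulti (p : ℕ) (x : Fin p → L) :
    gradeInv (ExteriorAlgebra.ιMulti ℂ p x) = (-1 : ℂ) ^ p • ExteriorAlgebra.ιMulti ℂ p x := by
  induction p with
  | zero => simp
  | succ p ih => rw [ιMulti_succ, map_mul, gradeInv_ι, ih, pow_succ]; simp

variable {g h x v w}

theorem gradeInv_of_mem {p : ℕ} (hw : w ∈ ⋀[ℂ]^p L) : gradeInv w = (-1 : ℂ) ^ p • w := by
  induction hw using ιMulti_induction with
  | hadd a b _ _ ha hb => rw [map_add, ha, hb, smul_add]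
  | hsmul c a _ ha => rw [map_smul, ha, smul_comm]
  | hι x => exact gradeInv_ιMulti p x

variable (g x)

theorem contr_ιMulti (p : ℕ) (x : Fin (p + 1) → L) :
    contr g (ExteriorAlgebra.ιMulti ℂ (p + 1) x) = ∑ k : Fin (p + 1),
      (-1 : ℂ) ^ (k : ℕ) • g (x k) • ExteriorAlgebra.ιMulti ℂ p (k.removeNth x) := by
  induction p with
  | zero => rw [ιMulti_succ, contr_ι_mul]; simp [contr_one]
  | succ p ih =>
    rw [ιMulti_succ, contr_ι_mul, ih, Fin.sum_univ_succ (n := p + 1), Finset.mul_sum, sub_eq_add_neg,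
      ← Finset.sum_neg_distrib]
    congr 1
    · simp [Matrix.vecTail, Fin.removeNth_zero, Fin.tail_def, Function.comp_def]
    · refine Finset.sum_congr rfl fun k _ => ?_
      have : k.succ.removeNth x = Matrix.vecCons (x 0) (k.removeNth (Matrix.vecTail x)) := by
        ext j
        refine Fin.cases ?_ (fun j => ?_) j
        · simp [Fin.removeNth]
        · simp [Fin.removeNth, Matrix.vecTail]
      rw [this, ιMulti_succ]
      simp [pow_succ, Matrix.vecTail, Function.comp_def]

theorem contr_mem {p : ℕ} (hw : w ∈ ⋀[ℂ]^(p + 1) L) : contr g w ∈ ⋀[ℂ]^p L := by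
  induction hw using ιMulti_induction with
  | hadd a b _ _ ha hb => rw [map_add]; exact add_mem ha hb
  | hsmul c a _ ha => rw [map_smul]; exact Submodule.smul_mem _ _ ha
  | hι x =>
    rw [contr_ιMulti]
    exact sum_mem fun k _ => Submodule.smul_mem _ _ (Submodule.smul_mem _ _ (ιMulti_mem _ _))

theorem contr_of_mem_zero (hw : w ∈ ⋀[ℂ]^0 L) : contr g w = 0 := by
  induction hw using ιMulti_induction with
  | hadd a b _ _ ha hb => rw [map_add, ha, hb, add_zero]
  | hsmul c a _ ha => rw [map_smul, ha, smul_zero]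
  | hι x => rw [ExteriorAlgebra.ιMulti_zero_apply, contr_one]

theorem ι_mul_mem {p : ℕ} (hw : w ∈ ⋀[ℂ]^p L) : ExteriorAlgebra.ι ℂ x * w ∈ ⋀[ℂ]^(p + 1) L := by
  have h1 : ExteriorAlgebra.ι ℂ x ∈ ⋀[ℂ]^1 L := by
    have := ιMulti_mem 1 (fun _ : Fin 1 => x)
    rwa [ιMulti_succ, ExteriorAlgebra.ιMulti_zero_apply, mul_one] at this
  rw [add_comm]
  exact SetLike.mul_mem_graded h1 hw

variable [FiniteDimensional ℂ L]

theorem eq_zero_of_mem_of_finrank_lt {p : ℕ} (hp : Module.finrank ℂ L < p)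
    (hw : w ∈ ⋀[ℂ]^p L) : w = 0 := by
  have h0 : Module.finrank ℂ (⋀[ℂ]^p L) = 0 := by
    rw [exteriorPower.finrank_eq, Nat.choose_eq_zero_of_lt hp]
  have := Module.finrank_zero_iff.1 h0
  exact congrArg Subtype.val (Subsingleton.elim (⟨w, hw⟩ : ⋀[ℂ]^p L) 0)

/-- Integration by parts: `v * w` vanishes for degree reasons, and contracting it by the Leibniz
rule gives two terms that must cancel. -/
theorem contr_mul_eq {i j : ℕ} (hij : Module.finrank ℂ L < i + j) (hv : v ∈ ⋀[ℂ]^i L)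
    (hw : w ∈ ⋀[ℂ]^j L) : contr g v * w = -((-1 : ℂ) ^ i • (v * contr g w)) := by
  have := contr_mul g v w
  rw [eq_zero_of_mem_of_finrank_lt hij (SetLike.mul_mem_graded hv hw), map_zero,
    gradeInv_of_mem hv, smul_mul_assoc] at this
  exact eq_neg_of_add_eq_zero_left this.symm

variable {ι : Type*} [Fintype ι] (b : Module.Basis ι ℂ L) {N : Type*} [AddCommGroup N] [Module ℂ N]

omit [FiniteDimensional ℂ L] in
-- The bridge between signed sums over removed wedge factors, as in the differential, and basis sums
-- of contractions, which are easier to commute with one another.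
theorem sum_contr_ιMulti (F : L →ₗ[ℂ] ExteriorAlgebra ℂ L →ₗ[ℂ] N) (p : ℕ) (x : Fin (p + 1) → L) :
    ∑ a, F (b a) (contr (b.coord a) (ExteriorAlgebra.ιMulti ℂ (p + 1) x)) =
      ∑ k : Fin (p + 1),
        (-1 : ℂ) ^ (k : ℕ) • F (x k) (ExteriorAlgebra.ιMulti ℂ p (k.removeNth x)) := by
  simp only [contr_ιMulti, map_sum, map_smul]
  rw [Finset.sum_comm]
  refine Finset.sum_congr rfl fun k _ => ?_
  rw [← Finset.smul_sum]
  congr 1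
  conv_rhs => rw [← b.sum_repr (x k)]
  rw [map_sum, LinearMap.sum_apply]
  simp

omit [FiniteDimensional ℂ L] in
-- Euler's formula: this operator counts the degree.
theorem sum_ι_mul_contr {p : ℕ} (hw : w ∈ ⋀[ℂ]^p L) :
    ∑ a, ExteriorAlgebra.ι ℂ (b a) * contr (b.coord a) w = (p : ℂ) • w := by
  induction hw using ιMulti_induction with
  | hadd v w _ _ hv hw => simp only [map_add, mul_add, Finset.sum_add_distrib, hv, hw, smul_add]
  | hsmul c w _ hw => simp only [map_smul, mul_smul_comm, ← Finset.smul_sum, hw, smul_comm c]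
  | hι x =>
    cases p with
    | zero => simp [contr_one]
    | succ p =>
      have h1 := sum_contr_ιMulti b ((LinearMap.mul ℂ (ExteriorAlgebra ℂ L)).comp
        (ExteriorAlgebra.ι ℂ)) p x
      have h2 := DFunLike.congr_fun (AlternatingMap.alternatizeUncurryFin_curryLeft
        (ExteriorAlgebra.ιMulti ℂ (M := L) (p + 1))) x
      rw [AlternatingMap.alternatizeUncurryFin_apply] at h2
      simp only [LinearMap.comp_apply, LinearMap.mul_apply'] at h1
      rw [h1]
      have h3 : ((p + 1) • ExteriorAlgebra.ιMulti ℂ (M := L) (p + 1)) x =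
          ((p + 1 : ℕ) : ℂ) • ExteriorAlgebra.ιMulti ℂ (p + 1) x := by
        rw [AlternatingMap.smul_apply, Nat.cast_smul_eq_nsmul]
      rw [← h3, ← h2]
      refine Finset.sum_congr rfl fun k _ => ?_
      rw [← Int.cast_smul_eq_zsmul ℂ, AlternatingMap.curryLeft_apply_apply, ιMulti_succ]
      simp [Matrix.vecTail, Function.comp_def]

theorem eq_zero_of_contr_eq_zero {p : ℕ} (hw : w ∈ ⋀[ℂ]^(p + 1) L)
    (h : ∀ g : Module.Dual ℂ L, contr g w = 0) : w = 0 := by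
  have := sum_ι_mul_contr (Module.finBasis ℂ L) hw
  simp only [h, mul_zero, Finset.sum_const_zero] at this
  exact (smul_eq_zero.1 this.symm).resolve_left (by exact_mod_cast p.succ_ne_zero)

/-- Contracting x ∧ w = 0 shows that each term of Euler's formula is `w` itself, so dim L times `w`
equals `p` times `w`. -/
theorem eq_zero_of_ι_mul_eq_zero {p : ℕ} (hp : p < Module.finrank ℂ L) (hw : w ∈ ⋀[ℂ]^p L)
    (h : ∀ x : L, ExteriorAlgebra.ι ℂ x * w = 0) : w = 0 := by
  have h1 := sum_ι_mul_contr (Module.finBasis ℂ L) hw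
  have h2 : ∀ a, ExteriorAlgebra.ι ℂ (Module.finBasis ℂ L a) *
      contr ((Module.finBasis ℂ L).coord a) w = w := by
    intro a
    have := contr_ι_mul ((Module.finBasis ℂ L).coord a) (Module.finBasis ℂ L a) w
    rw [h, map_zero] at this
    rw [← sub_eq_zero.1 this.symm]
    simp
  simp only [h2, Finset.sum_const, Finset.card_univ, Fintype.card_fin] at h1
  rw [← Nat.cast_smul_eq_nsmul ℂ, ← sub_eq_zero, ← sub_smul] at h1
  refine (smul_eq_zero.1 h1).resolve_left ?_
  rw [sub_eq_zero]
  exact_mod_cast hp.ne'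

/-- The wedge pairing between complementary exterior powers is nondegenerate. -/
theorem eq_zero_of_mul_eq_zero {p q : ℕ} (hpq : p + q = Module.finrank ℂ L) (hw : w ∈ ⋀[ℂ]^p L)
    (h : ∀ v ∈ ⋀[ℂ]^q L, w * v = 0) : w = 0 := by
  induction q generalizing p w with
  | zero => simpa using h 1 (by simp)
  | succ q ih =>
    refine eq_zero_of_ι_mul_eq_zero (by omega) hw fun x => ?_
    refine ih (by omega) (ι_mul_mem x hw) fun v hv => ?_
    rw [ι_mul_eq, gradeInv_of_mem hw, mul_assoc, smul_mul_assoc, h _ (ι_mul_mem x hv), smul_zero]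

end Contraction

/-! ### The bracket operator: its square and its transpose. -/

section BracketOperator

variable {L : Type*} [LieRing L] [LieAlgebra ℂ L] [FiniteDimensional ℂ L]

local notation "b" => Module.finBasis ℂ L

/-- The bracket part of the differential, as an operator on the whole exterior algebra. -/
noncomputable def bracketOp (L : Type*) [LieRing L] [LieAlgebra ℂ L] [FiniteDimensional ℂ L] :
    ExteriorAlgebra ℂ L →ₗ[ℂ] ExteriorAlgebra ℂ L :=
  (-(1 / 2) : ℂ) • ∑ i, ∑ j, (LinearMap.mulLeft ℂ (ExteriorAlgebra.ι ℂ
    ⁅Module.finBasis ℂ L i, Module.finBasis ℂ L j⁆)) ∘ₗ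
      contr ((Module.finBasis ℂ L).coord j) ∘ₗ contr ((Module.finBasis ℂ L).coord i)

theorem bracketOp_apply (w : ExteriorAlgebra ℂ L) : bracketOp L w =
    (-(1 / 2) : ℂ) • ∑ i, ∑ j, ExteriorAlgebra.ι ℂ ⁅b i, b j⁆ *
      contr ((b).coord j) (contr ((b).coord i) w) := by
  simp [bracketOp, LinearMap.sum_apply]

/-- Two applications of `sum_contr_ιMulti`, through the auxiliary map `G`, turn the double basis sum
into the double alternatization. -/
theorem bracketOp_ιMulti (p : ℕ) (x : Fin (p + 1) → L) :
    bracketOp L (ExteriorAlgebra.ιMulti ℂ (p + 1) x) = (bracketPart L p x : ExteriorAlgebra ℂ L) := by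
  cases p with
  | zero =>
    have h : ∀ i j, contr ((b).coord j) (contr ((b).coord i) (ExteriorAlgebra.ιMulti ℂ 1 x)) = 0 :=
      fun i j => contr_of_mem_zero _ (contr_mem _ (ιMulti_mem _ _))
    rw [bracketOp_apply]
    simp only [h, mul_zero, Finset.sum_const_zero, smul_zero]
    rfl
  | succ q =>
    let F : L →ₗ[ℂ] L →ₗ[ℂ] ExteriorAlgebra ℂ L →ₗ[ℂ] ExteriorAlgebra ℂ L :=
      LinearMap.compr₂ (LieModule.toEnd ℂ L L : L →ₗ[ℂ] L →ₗ[ℂ] L)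
        (LinearMap.mul ℂ (ExteriorAlgebra ℂ L) ∘ₗ ExteriorAlgebra.ι ℂ)
    have hF : ∀ x y w, F x y w = ExteriorAlgebra.ι ℂ ⁅x, y⁆ * w := fun _ _ _ => rfl
    let G : L →ₗ[ℂ] ExteriorAlgebra ℂ L →ₗ[ℂ] ExteriorAlgebra ℂ L :=
      LinearMap.mk₂ ℂ (fun x w => ∑ j, F x (b j) (contr ((b).coord j) w))
        (by intros; simp [Finset.sum_add_distrib])
        (by intros; simp [Finset.smul_sum])
        (by intros; simp [Finset.sum_add_distrib])
        (by intros; simp [Finset.smul_sum])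
    have hG : ∀ x w, G x w = ∑ j, F x (b j) (contr ((b).coord j) w) := fun _ _ => rfl
    have h1 := sum_contr_ιMulti (b) G (q + 1) x
    simp only [hG, sum_contr_ιMulti (b) (F _) q] at h1
    simp only [hF] at h1
    rw [bracketOp_apply, h1, bracketPart, AlternatingMap.alternatizeUncurryFin_apply]
    rw [AddSubmonoidClass.coe_finsetSum, Finset.smul_sum]
    refine Finset.sum_congr rfl fun i _ => ?_
    rw [LinearMap.comp_apply, AlternatingMap.alternatizeUncurryFinLM_apply,
      AlternatingMap.alternatizeUncurryFin_apply, ← Int.cast_smul_eq_zsmul ℂ, Submodule.coe_smul,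
      AddSubmonoidClass.coe_finsetSum, smul_comm]
    push_cast
    congr 1
    rw [Finset.smul_sum]
    refine Finset.sum_congr rfl fun j _ => ?_
    rw [← Int.cast_smul_eq_zsmul ℂ, smul_comm]
    push_cast
    congr 1
    simp only [LinearMap.smul_apply, LinearMap.compr₂_apply, AlternatingMap.smul_apply,
      AlternatingMap.curryLeft_apply_apply, LieHom.coe_toLinearMap, LieModule.toEnd_apply_apply,
      SetLike.val_smul, exteriorPower.ιMulti_apply_coe]
    rw [ιMulti_succ]
    simp [Matrix.vecTail, Function.comp_def]

theorem bracketOp_mem {p : ℕ} {w : ExteriorAlgebra ℂ L} (hw : w ∈ ⋀[ℂ]^(p + 1) L) :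
    bracketOp L w ∈ ⋀[ℂ]^p L := by
  induction hw using ιMulti_induction with
  | hadd v w _ _ hv hw => rw [map_add]; exact add_mem hv hw
  | hsmul c v _ hv => rw [map_smul]; exact Submodule.smul_mem _ _ hv
  | hι x => rw [bracketOp_ιMulti]; exact Subtype.prop _

/-- The anticommutator of `bracketOp` with the contraction by `g`. -/
noncomputable def contrBracket :
    Module.Dual ℂ L →ₗ[ℂ] ExteriorAlgebra ℂ L →ₗ[ℂ] ExteriorAlgebra ℂ L :=
  LinearMap.mk₂ ℂ (fun g w => (-(1 / 2) : ℂ) • ∑ i, ∑ j, g ⁅b i, b j⁆ •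
      contr ((b).coord j) (contr ((b).coord i) w))
    (by intros; simp [Finset.sum_add_distrib, add_smul, smul_add])
    (by intros; simp only [LinearMap.smul_apply, smul_assoc, ← Finset.smul_sum]; rw [smul_comm])
    (by intros; simp [Finset.sum_add_distrib])
    (by intro c g w; simp only [map_smul, smul_comm _ c, ← Finset.smul_sum])

variable (g h : Module.Dual ℂ L) (w : ExteriorAlgebra ℂ L)

theorem contrBracket_apply : contrBracket g w =
    (-(1 / 2) : ℂ) • ∑ i, ∑ j, g ⁅b i, b j⁆ •
      contr ((b).coord j) (contr ((b).coord i) w) := rfl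

omit [FiniteDimensional ℂ L] in
theorem contr_contr_contr (g h k : Module.Dual ℂ L) (w : ExteriorAlgebra ℂ L) :
    contr g (contr h (contr k w)) = contr h (contr k (contr g w)) := by
  rw [contr_comm g h, contr_comm g k, map_neg, neg_neg]

/-- Contracting the factor ⁅b i, b j⁆ produces the scalar term; in the other term the contraction
passes two contractions, an even permutation. -/
theorem contr_bracketOp :
    contr g (bracketOp L w) = contrBracket g w - bracketOp L (contr g w) := by
  rw [bracketOp_apply, bracketOp_apply, contrBracket_apply, map_smul, ← smul_sub,
    map_sum, ← Finset.sum_sub_distrib]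
  congr 1
  refine Finset.sum_congr rfl fun i _ => ?_
  rw [map_sum, ← Finset.sum_sub_distrib]
  refine Finset.sum_congr rfl fun j _ => ?_
  rw [contr_ι_mul, contr_contr_contr]

theorem contr_contrBracket : contr h (contrBracket g w) = contrBracket g (contr h w) := by
  rw [contrBracket_apply, contrBracket_apply, map_smul, map_sum]
  congr 1
  refine Finset.sum_congr rfl fun i _ => ?_
  rw [map_sum]
  refine Finset.sum_congr rfl fun j _ => ?_
  rw [map_smul, contr_contr_contr]

omit [FiniteDimensional ℂ L] [LieRing L] [LieAlgebra ℂ L] in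
theorem sum_rotate {ι M : Type*} [Fintype ι] [AddCommMonoid M] (T : ι → ι → ι → M) :
    ∑ k, ∑ i, ∑ j, T i j k = ∑ k, ∑ i, ∑ j, T j k i := by
  conv_rhs => rw [Finset.sum_comm]
  exact Finset.sum_congr rfl fun k _ => Finset.sum_comm

/-- The Jacobi identity, in terms of contractions. -/
theorem sum_contr_jacobi :
    ∑ k, ∑ i, ∑ j, g ⁅⁅b i, b j⁆, b k⁆ •
      contr ((b).coord j) (contr ((b).coord i) (contr ((b).coord k) w)) = 0 := by
  set C : Fin (Module.finrank ℂ L) → Fin (Module.finrank ℂ L) → Fin (Module.finrank ℂ L) →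
    ExteriorAlgebra ℂ L := fun j i k =>
      contr ((b).coord j) (contr ((b).coord i) (contr ((b).coord k) w)) with hC
  -- Cyclic rotation of three contractions is even. Renaming indices therefore writes `S` in three
  -- ways, and the coefficients of their sum vanish by the Jacobi identity.
  have hrot : ∀ i j k, C k j i = C j i k := fun i j k => contr_contr_contr _ _ _ w
  set S := ∑ k, ∑ i, ∑ j, g ⁅⁅b i, b j⁆, b k⁆ • C j i k with hS
  have h1 : S = ∑ k, ∑ i, ∑ j, g ⁅⁅b j, b k⁆, b i⁆ • C j i k := by
    rw [hS, sum_rotate fun i j k => g ⁅⁅b i, b j⁆, b k⁆ • C j i k]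
    exact Finset.sum_congr rfl fun k _ => Finset.sum_congr rfl fun i _ =>
      Finset.sum_congr rfl fun j _ => by rw [hrot]
  have h2 : S = ∑ k, ∑ i, ∑ j, g ⁅⁅b k, b i⁆, b j⁆ • C j i k := by
    rw [h1, sum_rotate fun i j k => g ⁅⁅b j, b k⁆, b i⁆ • C j i k]
    exact Finset.sum_congr rfl fun k _ => Finset.sum_congr rfl fun i _ =>
      Finset.sum_congr rfl fun j _ => by rw [hrot]
  have h3 : S + S + S = 0 := by
    conv_lhs => enter [2]; rw [h2]
    conv_lhs => enter [1, 2]; rw [h1]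
    rw [hS, ← Finset.sum_add_distrib, ← Finset.sum_add_distrib]
    refine Finset.sum_eq_zero fun k _ => ?_
    rw [← Finset.sum_add_distrib, ← Finset.sum_add_distrib]
    refine Finset.sum_eq_zero fun i _ => ?_
    rw [← Finset.sum_add_distrib, ← Finset.sum_add_distrib]
    refine Finset.sum_eq_zero fun j _ => ?_
    rw [← add_smul, ← add_smul, ← map_add, ← map_add]
    have : ⁅⁅b i, b j⁆, b k⁆ + ⁅⁅b j, b k⁆, b i⁆ + ⁅⁅b k, b i⁆, b j⁆ = 0 := by
      rw [← lie_skew ⁅b i, b j⁆, ← lie_skew ⁅b j, b k⁆, ← lie_skew ⁅b k, b i⁆, ← neg_add,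
        ← neg_add, neg_eq_zero, add_comm, ← add_assoc, add_comm ⁅b j, _⁆, add_assoc]
      have := lie_jacobi (b i) (b j) (b k)
      rw [← this]
      abel
    rw [this, map_zero, zero_smul]
  have h4 : (3 : ℂ) • S = 0 := by
    rw [← h3]
    module
  exact (smul_eq_zero.1 h4).resolve_left (by norm_num)

/-- Expanding the functional x ↦ g ⁅x, b j⁆ in coordinates reduces this to the sum in
`sum_contr_jacobi`. -/
theorem sum_contrBracket_contr :
    ∑ i, ∑ j, g ⁅b i, b j⁆ • contrBracket ((b).coord i) (contr ((b).coord j) w) = 0 := by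
  have h : ∀ y : L, ∑ i, g ⁅b i, y⁆ • (b).coord i =
      g ∘ₗ ((LieModule.toEnd ℂ L L : L →ₗ[ℂ] L →ₗ[ℂ] L).flip y) := by
    intro y
    refine (b).ext fun k => ?_
    simp [LinearMap.sum_apply, Finsupp.single_apply]
  rw [Finset.sum_comm]
  have h' : ∀ j, ∑ i, g ⁅b i, b j⁆ • contrBracket ((b).coord i) (contr ((b).coord j) w) =
      (-(1 / 2) : ℂ) • ∑ i, ∑ k, g ⁅⁅b i, b k⁆, b j⁆ •
      contr ((b).coord k) (contr ((b).coord i) (contr ((b).coord j) w)) := by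
    intro j
    have := congrArg (fun f => contrBracket f (contr ((b).coord j) w)) (h (b j))
    simp only [map_sum, map_smul, LinearMap.sum_apply, LinearMap.smul_apply] at this
    rw [this, contrBracket_apply]
    rfl
  simp only [h', ← Finset.smul_sum]
  rw [sum_contr_jacobi, smul_zero]

/-- Moving two contractions past the bracket operator leaves two correction sums, each zero by
Jacobi. -/
theorem contrBracket_bracketOp :
    contrBracket g (bracketOp L w) = bracketOp L (contrBracket g w) := by
  have h : ∀ i j, contr ((b).coord j) (contr ((b).coord i) (bracketOp L w)) =
      contrBracket ((b).coord i) (contr ((b).coord j) w) -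
      contrBracket ((b).coord j) (contr ((b).coord i) w) +
      bracketOp L (contr ((b).coord j) (contr ((b).coord i) w)) := by
    intro i j
    rw [contr_bracketOp, map_sub, contr_contrBracket, contr_bracketOp]
    abel
  have h2 : ∑ i, ∑ j, g ⁅b i, b j⁆ • contrBracket ((b).coord j) (contr ((b).coord i) w) = 0 := by
    rw [Finset.sum_comm, ← neg_eq_zero, ← sum_contrBracket_contr g w]
    simp only [← Finset.sum_neg_distrib, ← neg_smul, ← map_neg, lie_skew]
  rw [contrBracket_apply, contrBracket_apply]
  simp only [h, smul_add, smul_sub, Finset.sum_add_distrib, Finset.sum_sub_distrib, map_smul,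
    map_sum, sum_contrBracket_contr, h2, sub_zero, zero_add]

/-- The square commutes with every contraction, and an element of positive degree killed by all
contractions is zero, so induction on the degree applies. It starts because the bracket operator
vanishes in degree one. -/
theorem bracketOp_bracketOp {p : ℕ} (hw : w ∈ ⋀[ℂ]^(p + 2) L) :
    bracketOp L (bracketOp L w) = 0 := by
  have hc : ∀ g w, contr g (bracketOp L (bracketOp L w)) =
      bracketOp L (bracketOp L (contr g w)) := by
    intro g w
    rw [contr_bracketOp, contr_bracketOp, contrBracket_bracketOp, map_sub]
    abel
  have h1 : ∀ w ∈ ⋀[ℂ]^1 L, bracketOp L w = 0 := by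
    intro w hw
    rw [bracketOp_apply]
    have h : ∀ i j, contr ((b).coord j) (contr ((b).coord i) w) = 0 :=
      fun i j => contr_of_mem_zero _ (contr_mem _ hw)
    simp [h]
  induction p generalizing w with
  | zero => exact h1 _ (bracketOp_mem hw)
  | succ p ih =>
    refine eq_zero_of_contr_eq_zero (bracketOp_mem (bracketOp_mem hw)) fun g => ?_
    rw [hc]
    exact ih _ (contr_mem g hw)

variable (L) in
/-- The functional `x ↦ trace (ad x)`. -/
noncomputable def traceAd : Module.Dual ℂ L :=
  LinearMap.trace ℂ L ∘ₗ (LieModule.toEnd ℂ L L : L →ₗ[ℂ] Module.End ℂ L)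

theorem traceAd_apply (x : L) : traceAd L x = ∑ j, (b).coord j ⁅x, b j⁆ := by
  rw [traceAd, LinearMap.comp_apply, LinearMap.trace_eq_matrix_trace ℂ (b), Matrix.trace]
  refine Finset.sum_congr rfl fun j _ => ?_
  rw [Matrix.diag_apply, LinearMap.toMatrix_apply]
  rfl

theorem contr_traceAd : contr (traceAd L) w =
    ∑ i, ∑ j, (b).coord j ⁅b i, b j⁆ • contr ((b).coord i) w := by
  have : traceAd L = ∑ i, traceAd L (b i) • (b).coord i := by
    refine (b).ext fun k => ?_
    rw [LinearMap.sum_apply]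
    simp [Finsupp.single_apply]
  conv_lhs => rw [this]
  simp only [map_sum, LinearMap.sum_apply, map_smul, LinearMap.smul_apply, traceAd_apply,
    Finset.sum_smul]

omit [FiniteDimensional ℂ L] in
theorem coord_lie_swap {ι : Type*} (c : Module.Basis ι ℂ L) (i j k : ι) :
    c.coord k ⁅c i, c j⁆ = -c.coord k ⁅c j, c i⁆ := by
  rw [← map_neg, lie_skew]

/-- The bracket operator and its negative are adjoint for the wedge pairing between complementary
degrees, up to the contraction by `traceAd`. -/
theorem bracketOp_mul {p q : ℕ} (hpq : p + q + 1 = Module.finrank ℂ L)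
    {v w : ExteriorAlgebra ℂ L} (hv : v ∈ ⋀[ℂ]^(p + 1) L) (hw : w ∈ ⋀[ℂ]^(q + 1) L) :
    bracketOp L v * w =
      (-1 : ℂ) ^ p • (v * (-contr (traceAd L) w - bracketOp L w)) := by
  -- Move x across to `w`, then integrate by parts twice. Contracting x ∧ w leaves the two scalar
  -- terms responsible for the trace.
  have hterm : ∀ (x : L) (g h : Module.Dual ℂ L),
      ExteriorAlgebra.ι ℂ x * contr h (contr g v) * w =
        (-1 : ℂ) ^ p • (v * (h x • contr g w - g x • contr h w -
          ExteriorAlgebra.ι ℂ x * contr h (contr g w))) := by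
    intro x g h
    have hs : ((-1 : ℂ) ^ p) * (-1 : ℂ) ^ p = 1 := by rw [← mul_pow]; simp
    have h1 : ExteriorAlgebra.ι ℂ x * contr h (contr g v) * w =
        (-1 : ℂ) ^ (p + 1) • (contr h (contr g v) * (ExteriorAlgebra.ι ℂ x * w)) := by
      have h2 : gradeInv (contr h (contr g v)) = (-1 : ℂ) ^ (p + 1) • contr h (contr g v) := by
        rw [← map_smul, ← map_smul, ← gradeInv_of_mem hv, contr_gradeInv, map_neg,
          contr_gradeInv, neg_neg]
      rw [ι_mul_eq, h2, smul_mul_assoc, smul_mul_assoc, mul_assoc]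
    have h3 : contr g (contr h (ExteriorAlgebra.ι ℂ x * w)) = h x • contr g w - g x • contr h w -
          ExteriorAlgebra.ι ℂ x * contr h (contr g w) := by
      rw [contr_ι_mul, map_sub, map_smul, contr_ι_mul, contr_comm g h w]
      simp [sub_eq_add_neg]
      abel
    rw [h1, contr_mul_eq h (by omega) (contr_mem g hv) (ι_mul_mem x hw),
      contr_mul_eq g (by omega) hv (contr_mem h (ι_mul_mem x hw)), h3, smul_neg, smul_neg, smul_neg,
      neg_neg, smul_smul, smul_smul, pow_succ]
    congr 1
    linear_combination (-1 : ℂ) ^ p * hs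
  -- By antisymmetry the two scalar sums are opposite; their difference is twice the contraction by
  -- `traceAd`, which cancels the factor 1/2.
  have hswap : ∑ i, ∑ j, (b).coord i ⁅b i, b j⁆ • contr ((b).coord j) w =
      -contr (traceAd L) w := by
    rw [contr_traceAd, Finset.sum_comm, ← Finset.sum_neg_distrib]
    refine Finset.sum_congr rfl fun i _ => ?_
    rw [← Finset.sum_neg_distrib]
    refine Finset.sum_congr rfl fun j _ => ?_
    rw [← neg_smul, coord_lie_swap]
  rw [bracketOp_apply, bracketOp_apply, smul_mul_assoc, Finset.sum_mul]
  simp only [Finset.sum_mul, hterm, ← Finset.smul_sum, ← Finset.mul_sum, Finset.sum_sub_distrib]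
  rw [hswap, ← contr_traceAd, smul_comm, ← mul_smul_comm]
  congr 2
  module

end BracketOperator

/-! ### The differential as one operator on `E ⊗ ⋀ L`, and d² = 0. -/

theorem tensor_ιMulti_ext {E L N : Type*} [AddCommGroup E] [Module ℂ E] [AddCommGroup L]
    [Module ℂ L] [AddCommGroup N] [Module ℂ N] {p : ℕ} {A B : E ⊗[ℂ] ⋀[ℂ]^p L →ₗ[ℂ] N}
    (h : ∀ e x, A (e ⊗ₜ exteriorPower.ιMulti ℂ p x) = B (e ⊗ₜ exteriorPower.ιMulti ℂ p x)) :
    A = B := by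
  refine TensorProduct.ext (LinearMap.ext fun e => exteriorPower.linearMap_ext ?_)
  ext x
  exact h e x

section TotalDifferential

variable {L : Type*} [LieRing L] [LieAlgebra ℂ L]
variable {E : Type*} [NormedAddCommGroup E] [NormedSpace ℂ E]

/-- The operators `e ↦ e (x - f x)`. -/
noncomputable def twistedOp (π : RightAction L E) (f : Module.Dual ℂ L) : L →ₗ[ℂ] E →ₗ[ℂ] E :=
  ContinuousLinearMap.coeLM ℂ ∘ₗ π.op - LinearMap.toSpanSingleton ℂ _ LinearMap.id ∘ₗ f

theorem twistedOp_apply (π : RightAction L E) (f : Module.Dual ℂ L) (x : L) (e : E) :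
    twistedOp π f x e = π.op x e - f x • e := rfl

theorem apply_lie_eq_zero {f : Module.Dual ℂ L} (hf : f ∈ (derivedSubspace L).dualAnnihilator)
    (x y : L) : f ⁅x, y⁆ = 0 :=
  (Submodule.mem_dualAnnihilator f).1 hf _
    (LieSubmodule.lie_mem_lie (LieSubmodule.mem_top x) (LieSubmodule.mem_top y))

/-- Since f vanishes on brackets, subtracting the scalars f x preserves the right-action identity.
-/
theorem twistedOp_lie (π : RightAction L E) {f : Module.Dual ℂ L}
    (hf : f ∈ (derivedSubspace L).dualAnnihilator) (x y : L) (e : E) :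
    twistedOp π f ⁅x, y⁆ e = twistedOp π f y (twistedOp π f x e) -
      twistedOp π f x (twistedOp π f y e) := by
  simp only [twistedOp_apply, π.op_lie, apply_lie_eq_zero hf, map_sub, map_smul]
  module

variable [FiniteDimensional ℂ L]

/-- The differential, as an operator on `E ⊗ ⋀ L`. -/
noncomputable def totalDifferential (π : RightAction L E) (f : Module.Dual ℂ L) :
    E ⊗[ℂ] ExteriorAlgebra ℂ L →ₗ[ℂ] E ⊗[ℂ] ExteriorAlgebra ℂ L :=
  ∑ i, TensorProduct.map (twistedOp π f (Module.finBasis ℂ L i))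
    (contr ((Module.finBasis ℂ L).coord i)) + LinearMap.lTensor E (bracketOp L)

theorem totalDifferential_tmul (π : RightAction L E) (f : Module.Dual ℂ L) (e : E)
    (w : ExteriorAlgebra ℂ L) : totalDifferential π f (e ⊗ₜ w) =
      ∑ i, twistedOp π f (Module.finBasis ℂ L i) e ⊗ₜ[ℂ] contr ((Module.finBasis ℂ L).coord i) w +
        e ⊗ₜ[ℂ] bracketOp L w := by
  simp [totalDifferential, LinearMap.sum_apply]

theorem lTensor_subtype_differential (π : RightAction L E) (f : Module.Dual ℂ L) (p : ℕ)
    (u : E ⊗[ℂ] ⋀[ℂ]^(p + 1) L) :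
    LinearMap.lTensor E (⋀[ℂ]^p L).subtype (differential π f p u) =
      totalDifferential π f (LinearMap.lTensor E (⋀[ℂ]^(p + 1) L).subtype u) := by
  suffices h : LinearMap.lTensor E (⋀[ℂ]^p L).subtype ∘ₗ differential π f p =
      totalDifferential π f ∘ₗ LinearMap.lTensor E (⋀[ℂ]^(p + 1) L).subtype from
    DFunLike.congr_fun h u
  refine tensor_ιMulti_ext fun e x => ?_
  have h1 := sum_contr_ιMulti (Module.finBasis ℂ L)
    ((TensorProduct.mk ℂ E (ExteriorAlgebra ℂ L)) ∘ₗ (twistedOp π f).flip e) p x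
  simp only [LinearMap.comp_apply, TensorProduct.mk_apply, LinearMap.flip_apply] at h1
  simp only [LinearMap.comp_apply, differential_tmul, LinearMap.lTensor_tmul, totalDifferential_tmul,
    Submodule.subtype_apply, exteriorPower.ιMulti_apply_coe, bracketOp_ιMulti, map_add, map_sum,
    map_smul, h1, ← twistedOp_apply]

/-- The square splits into the squared action part `S`, the cross terms and the squared bracket
part. The cross terms are anticommutators with contractions and add up to -(1/2)(2 S); the last part
is zero. -/
theorem totalDifferential_totalDifferential_tmul (π : RightAction L E) {f : Module.Dual ℂ L}
    (hf : f ∈ (derivedSubspace L).dualAnnihilator) {p : ℕ} (e : E)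
    {w : ExteriorAlgebra ℂ L} (hw : w ∈ ⋀[ℂ]^(p + 2) L) :
    totalDifferential π f (totalDifferential π f (e ⊗ₜ w)) = 0 := by
  set b := Module.finBasis ℂ L with hb
  set T := twistedOp π f with hT
  set S := ∑ i, ∑ j, T (b j) (T (b i) e) ⊗ₜ[ℂ] contr (b.coord j) (contr (b.coord i) w) with hS
  have h1 : ∑ j, T (b j) e ⊗ₜ[ℂ] contrBracket (b.coord j) w =
      (-(1 / 2) : ℂ) • ∑ i, ∑ k, T ⁅b i, b k⁆ e ⊗ₜ[ℂ] contr (b.coord k) (contr (b.coord i) w) := by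
    simp only [contrBracket_apply, TensorProduct.tmul_smul, ← Finset.smul_sum,
      TensorProduct.tmul_sum]
    congr 1
    rw [Finset.sum_comm]
    refine Finset.sum_congr rfl fun i _ => ?_
    rw [Finset.sum_comm]
    refine Finset.sum_congr rfl fun k _ => ?_
    conv_rhs => rw [← b.sum_repr ⁅b i, b k⁆]
    rw [map_sum, LinearMap.sum_apply, TensorProduct.sum_tmul]
    refine Finset.sum_congr rfl fun j _ => ?_
    rw [map_smul, LinearMap.smul_apply, TensorProduct.smul_tmul', TensorProduct.smul_tmul,
      TensorProduct.tmul_smul]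
    rfl
  have h2 : ∑ i, ∑ k, T (b i) (T (b k) e) ⊗ₜ[ℂ] contr (b.coord k) (contr (b.coord i) w) = -S := by
    rw [hS, Finset.sum_comm, ← Finset.sum_neg_distrib]
    refine Finset.sum_congr rfl fun i _ => ?_
    rw [← Finset.sum_neg_distrib]
    refine Finset.sum_congr rfl fun j _ => ?_
    rw [contr_comm, TensorProduct.tmul_neg]
  have h3 : ∑ i, ∑ k, T ⁅b i, b k⁆ e ⊗ₜ[ℂ] contr (b.coord k) (contr (b.coord i) w) =
      (2 : ℂ) • S := by
    simp only [hT, twistedOp_lie π hf, TensorProduct.sub_tmul, Finset.sum_sub_distrib]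
    rw [← hT, h2, ← hS]
    module
  rw [totalDifferential_tmul, map_add, map_sum]
  simp only [totalDifferential_tmul, Finset.sum_add_distrib, bracketOp_bracketOp w hw,
    TensorProduct.tmul_zero, add_zero, contr_bracketOp, TensorProduct.tmul_sub,
    Finset.sum_sub_distrib]
  rw [← hb, ← hT, h1, h3, ← hS]
  module

theorem differential_differential (π : RightAction L E) {f : Module.Dual ℂ L}
    (hf : f ∈ (derivedSubspace L).dualAnnihilator) (p : ℕ) (u : E ⊗[ℂ] ⋀[ℂ]^(p + 2) L) :
    differential π f p (differential π f (p + 1) u) = 0 := by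
  -- Flatness of `E` lets the identity be checked in the whole exterior algebra.
  have hinj := Module.Flat.lTensor_preserves_injective_linearMap (M := E)
    (⋀[ℂ]^p L).subtype (Submodule.injective_subtype _)
  refine hinj ?_
  rw [lTensor_subtype_differential, lTensor_subtype_differential, map_zero]
  induction u using TensorProduct.induction_on with
  | zero => simp
  | add u v hu hv => simp only [map_add, hu, hv, add_zero]
  | tmul e w => exact totalDifferential_totalDifferential_tmul π hf e w.2

end TotalDifferential

/-! ### Transporting Banach duality to `E ⊗ V` with `V` finite-dimensional. -/

section TensorComplex

variable {E : Type*} [NormedAddCommGroup E] [NormedSpace ℂ E]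

/-- The isomorphism of `E ⊗ V` with a power of `E`, for `V` of finite dimension. -/
noncomputable def tensorPi (E V : Type*) [NormedAddCommGroup E] [NormedSpace ℂ E]
    [AddCommGroup V] [Module ℂ V] [FiniteDimensional ℂ V] :
    E ⊗[ℂ] V ≃ₗ[ℂ] (Fin (Module.finrank ℂ V) → E) :=
  TensorProduct.equivFinsuppOfBasisRight (Module.finBasis ℂ V) ≪≫ₗ
    Finsupp.linearEquivFunOnFinite ℂ E _

section

variable {V : Type*} [AddCommGroup V] [Module ℂ V] [FiniteDimensional ℂ V]

theorem tensorPi_tmul (e : E) (v : V) (i : Fin (Module.finrank ℂ V)) :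
    tensorPi E V (e ⊗ₜ v) i = (Module.finBasis ℂ V).repr v i • e := by
  simp [tensorPi]

theorem tensorPi_symm_apply (a : Fin (Module.finrank ℂ V) → E) :
    (tensorPi E V).symm a = ∑ i, a i ⊗ₜ[ℂ] Module.finBasis ℂ V i := by
  rw [LinearEquiv.symm_apply_eq]
  ext i
  rw [map_sum, Finset.sum_apply]
  simp [tensorPi_tmul, Finsupp.single_apply]

theorem continuous_tensorPi_tmul (v : V) : Continuous fun e : E => tensorPi E V (e ⊗ₜ v) := by
  refine continuous_pi fun i => ?_
  simp only [tensorPi_tmul]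
  exact continuous_const_smul _

/-- A linear form on `E ⊗ V` is continuous if it is so on each `E ⊗ v`. -/
def IsSliceContinuous {V : Type*} [AddCommGroup V] [Module ℂ V] (F : E ⊗[ℂ] V →ₗ[ℂ] ℂ) : Prop :=
  ∀ v, Continuous fun e => F (e ⊗ₜ v)

/-- With `IsSliceContinuous.exists_dual`, this identifies slice-continuous forms with the dual of a
power of `E`, so the tensor product itself needs no norm. -/
theorem isSliceContinuous_comp_tensorPi (φ : StrongDual ℂ (Fin (Module.finrank ℂ V) → E)) :
    IsSliceContinuous (φ.toLinearMap ∘ₗ (tensorPi E V).toLinearMap) := fun v =>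
  φ.continuous.comp (continuous_tensorPi_tmul v)

theorem IsSliceContinuous.exists_dual {F : E ⊗[ℂ] V →ₗ[ℂ] ℂ} (hF : IsSliceContinuous F) :
    ∃ φ : StrongDual ℂ (Fin (Module.finrank ℂ V) → E),
      F = φ.toLinearMap ∘ₗ (tensorPi E V).toLinearMap := by
  refine ⟨⟨F ∘ₗ (tensorPi E V).symm.toLinearMap, ?_⟩, ?_⟩
  · have : ∀ a, (F ∘ₗ (tensorPi E V).symm.toLinearMap) a =
        ∑ i, F (a i ⊗ₜ Module.finBasis ℂ V i) := by
      intro a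
      rw [LinearMap.comp_apply, LinearEquiv.coe_coe, tensorPi_symm_apply, map_sum]
    change Continuous fun a => (F ∘ₗ (tensorPi E V).symm.toLinearMap) a
    simp only [this]
    exact continuous_finsetSum _ fun i _ => (hF _).comp (continuous_apply i)
  · refine LinearMap.ext fun u => ?_
    simp

end

variable [CompleteSpace E] {V : ℕ → Type*} [∀ p, AddCommGroup (V p)] [∀ p, Module ℂ (V p)]
  [∀ p, FiniteDimensional ℂ (V p)]

theorem exact_iff_dual_exact_tensor (d : ∀ p, E ⊗[ℂ] V (p + 1) →ₗ[ℂ] E ⊗[ℂ] V p)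
    (hd : ∀ p v, Continuous fun e => tensorPi E (V p) (d p (e ⊗ₜ v)))
    (hdd : ∀ p x, d p (d (p + 1) x) = 0) :
    ((∀ x, ∃ y, d 0 y = x) ∧ ∀ p x, d p x = 0 → ∃ y, d (p + 1) y = x) ↔
    ((∀ F : E ⊗[ℂ] V 0 →ₗ[ℂ] ℂ, IsSliceContinuous F → F ∘ₗ d 0 = 0 → F = 0) ∧
      ∀ p, ∀ F : E ⊗[ℂ] V (p + 1) →ₗ[ℂ] ℂ, IsSliceContinuous F → F ∘ₗ d (p + 1) = 0 →
        ∃ G : E ⊗[ℂ] V p →ₗ[ℂ] ℂ, IsSliceContinuous G ∧ G ∘ₗ d p = F) := by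
  let D : ∀ p, (Fin (Module.finrank ℂ (V (p + 1))) → E) →L[ℂ] (Fin (Module.finrank ℂ (V p)) → E) :=
    fun p => ⟨(tensorPi E (V p)).toLinearMap ∘ₗ d p ∘ₗ (tensorPi E (V (p + 1))).symm.toLinearMap, by
      change Continuous fun a => tensorPi E (V p) (d p ((tensorPi E (V (p + 1))).symm a))
      simp only [tensorPi_symm_apply, map_sum]
      exact continuous_finsetSum _ fun i _ => (hd p _).comp (continuous_apply i)⟩
  have hD : ∀ p u, D p (tensorPi E (V (p + 1)) u) = tensorPi E (V p) (d p u) := by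
    intro p u
    change tensorPi E (V p) (d p ((tensorPi E (V (p + 1))).symm _)) = _
    rw [LinearEquiv.symm_apply_apply]
  have key := exact_iff_dual_exact
    (X := fun p => Fin (Module.finrank ℂ (V p)) → E) D (fun p x => by
    obtain ⟨u, rfl⟩ := (tensorPi E (V (p + 2))).surjective x
    rw [hD, hD, hdd, map_zero])
  have hzero : ∀ p (φ : StrongDual ℂ (Fin (Module.finrank ℂ (V p)) → E)), φ.comp (D p) = 0 ↔
      (φ.toLinearMap ∘ₗ (tensorPi E (V p)).toLinearMap) ∘ₗ d p = 0 := by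
    intro p φ
    constructor
    · intro h
      refine LinearMap.ext fun u => ?_
      have := DFunLike.congr_fun h (tensorPi E (V (p + 1)) u)
      simpa [hD] using this
    · intro h
      refine ContinuousLinearMap.ext fun a => ?_
      obtain ⟨u, rfl⟩ := (tensorPi E (V (p + 1))).surjective a
      have := DFunLike.congr_fun h u
      simpa [hD] using this
  constructor
  · rintro ⟨h0, h1⟩
    obtain ⟨k0, k1⟩ := key.1 ⟨fun x => by
      obtain ⟨u, rfl⟩ := (tensorPi E (V 0)).surjective x
      obtain ⟨y, rfl⟩ := h0 u
      exact ⟨_, hD 0 y⟩, fun p x hx => by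
      obtain ⟨u, rfl⟩ := (tensorPi E (V (p + 1))).surjective x
      rw [hD, LinearEquiv.map_eq_zero_iff] at hx
      obtain ⟨y, rfl⟩ := h1 p u hx
      exact ⟨_, hD (p + 1) y⟩⟩
    refine ⟨fun F hF hF0 => ?_, fun p F hF hF0 => ?_⟩
    · obtain ⟨φ, rfl⟩ := hF.exists_dual
      rw [k0 φ ((hzero 0 φ).2 hF0)]
      rfl
    · obtain ⟨φ, rfl⟩ := hF.exists_dual
      obtain ⟨ψ, rfl⟩ := k1 p φ ((hzero (p + 1) φ).2 hF0)
      refine ⟨_, isSliceContinuous_comp_tensorPi ψ, ?_⟩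
      refine LinearMap.ext fun u => ?_
      simp [hD]
  · rintro ⟨h0, h1⟩
    obtain ⟨k0, k1⟩ := key.2 ⟨fun φ hφ => by
      have := h0 _ (isSliceContinuous_comp_tensorPi φ) ((hzero 0 φ).1 hφ)
      refine ContinuousLinearMap.ext fun a => ?_
      obtain ⟨u, rfl⟩ := (tensorPi E (V 0)).surjective a
      exact DFunLike.congr_fun this u, fun p φ hφ => by
      obtain ⟨G, hG, hGd⟩ := h1 p _ (isSliceContinuous_comp_tensorPi φ) ((hzero (p + 1) φ).1 hφ)
      obtain ⟨ψ, rfl⟩ := hG.exists_dual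
      refine ⟨ψ, ContinuousLinearMap.ext fun a => ?_⟩
      obtain ⟨u, rfl⟩ := (tensorPi E (V (p + 1))).surjective a
      have := DFunLike.congr_fun hGd u
      simpa [hD] using this⟩
    refine ⟨fun x => ?_, fun p x hx => ?_⟩
    · obtain ⟨y, hy⟩ := k0 (tensorPi E (V 0) x)
      obtain ⟨u, rfl⟩ := (tensorPi E (V 1)).surjective y
      rw [hD] at hy
      exact ⟨u, (tensorPi E (V 0)).injective hy⟩
    · obtain ⟨y, hy⟩ := k1 p (tensorPi E (V (p + 1)) x) (by rw [hD, hx, map_zero])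
      obtain ⟨u, rfl⟩ := (tensorPi E (V (p + 2))).surjective y
      rw [hD] at hy
      exact ⟨u, (tensorPi E (V (p + 1))).injective hy⟩

end TensorComplex

/-! ### Vanishing homology as exactness. -/

section Exactness

variable {L : Type*} [LieRing L] [LieAlgebra ℂ L]
variable {E : Type*} [NormedAddCommGroup E] [NormedSpace ℂ E]

theorem not_nontrivial_homology_iff (π : RightAction L E) (f : Module.Dual ℂ L) (p : ℕ) :
    ¬ Nontrivial (Homology π f p) ↔ ∀ u ∈ cycles π f p, ∃ v, differential π f p v = u := by
  rw [Submodule.Quotient.nontrivial_iff, not_not, Submodule.comap_subtype_eq_top]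
  rfl

theorem exists_nontrivial_homology_iff (π : RightAction L E) (f : Module.Dual ℂ L) :
    (∃ p, Nontrivial (Homology π f p)) ↔
      ¬ ∀ p, ∀ u ∈ cycles π f p, ∃ v, differential π f p v = u := by
  simp only [← not_nontrivial_homology_iff, not_forall, not_not]

theorem continuous_tensorPi_differential [FiniteDimensional ℂ L] (π : RightAction L E)
    (f : Module.Dual ℂ L) (p : ℕ) (v : ⋀[ℂ]^(p + 1) L) :
    Continuous fun e => tensorPi E (⋀[ℂ]^p L) (differential π f p (e ⊗ₜ v)) := by
  have hv : v ∈ Submodule.span ℂ (Set.range (exteriorPower.ιMulti ℂ (p + 1) (M := L))) := by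
    rw [exteriorPower.ιMulti_span]
    exact Submodule.mem_top
  induction hv using Submodule.span_induction with
  | mem v hv =>
    obtain ⟨x, rfl⟩ := hv
    simp only [differential_tmul, map_add, map_sum, map_smul]
    refine Continuous.add (continuous_finsetSum _ fun k _ => ?_) (continuous_tensorPi_tmul _)
    exact ((continuous_tensorPi_tmul _).comp
      ((π.op (x k)).continuous.sub (continuous_const_smul (f (x k))))).const_smul ((-1 : ℂ) ^ (k : ℕ))
  | zero => simpa using continuous_const
  | add v w _ _ hv hw =>
    simp only [TensorProduct.tmul_add, map_add]
    exact hv.add hw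
  | smul c v _ hv =>
    simp only [TensorProduct.tmul_smul, map_smul]
    exact hv.const_smul c

theorem exact_iff_dual_exact_differential [FiniteDimensional ℂ L] [CompleteSpace E]
    (π : RightAction L E) {f : Module.Dual ℂ L} (hf : f ∈ (derivedSubspace L).dualAnnihilator) :
    (∀ p, ∀ u ∈ cycles π f p, ∃ v, differential π f p v = u) ↔
    ((∀ F : E ⊗[ℂ] ⋀[ℂ]^0 L →ₗ[ℂ] ℂ, IsSliceContinuous F → F ∘ₗ differential π f 0 = 0 → F = 0) ∧
      ∀ p, ∀ F : E ⊗[ℂ] ⋀[ℂ]^(p + 1) L →ₗ[ℂ] ℂ, IsSliceContinuous F →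
        F ∘ₗ differential π f (p + 1) = 0 →
        ∃ G : E ⊗[ℂ] ⋀[ℂ]^p L →ₗ[ℂ] ℂ, IsSliceContinuous G ∧ G ∘ₗ differential π f p = F) := by
  rw [← exact_iff_dual_exact_tensor (V := fun p => ⋀[ℂ]^p L) (fun p => differential π f p)
    (continuous_tensorPi_differential π f) (differential_differential π hf)]
  constructor
  · exact fun h => ⟨fun x => h 0 x trivial, fun p x hx => h (p + 1) x hx⟩
  · rintro ⟨h0, h1⟩ (_ | p) u hu
    · exact h0 u
    · exact h1 p u hu

end Exactness

/-! ### The pairing with `E^* ⊗ ⋀ L'` and the transposed differential. -/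

section Duality

variable {L : Type*} [LieRing L] [LieAlgebra ℂ L]
variable {E : Type*} [NormedAddCommGroup E] [NormedSpace ℂ E]

instance [FiniteDimensional ℂ L] : FiniteDimensional ℂ (OppositeLie L) :=
  Module.Finite.equiv (toOpposite L)

/-- The identity `⋀ L' → ⋀ L`. -/
noncomputable def unop (L : Type*) [LieRing L] [LieAlgebra ℂ L] :
    ExteriorAlgebra ℂ (OppositeLie L) →ₐ[ℂ] ExteriorAlgebra ℂ L :=
  ExteriorAlgebra.map (toOpposite L).symm.toLinearMap

theorem unop_ιMulti {q : ℕ} (y : Fin q → OppositeLie L) : unop L (ExteriorAlgebra.ιMulti ℂ q y) =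
    ExteriorAlgebra.ιMulti ℂ q (fun i => (toOpposite L).symm (y i)) :=
  ExteriorAlgebra.map_apply_ιMulti _ _

theorem unop_mem {q : ℕ} {v : ExteriorAlgebra ℂ (OppositeLie L)}
    (hv : v ∈ ⋀[ℂ]^q (OppositeLie L)) : unop L v ∈ ⋀[ℂ]^q L := by
  induction hv using ιMulti_induction with
  | hadd v w _ _ hv hw => rw [map_add]; exact add_mem hv hw
  | hsmul c v _ hv => rw [map_smul]; exact Submodule.smul_mem _ _ hv
  | hι y => rw [unop_ιMulti]; exact ιMulti_mem _ _

theorem exists_unop_eq {q : ℕ} {w : ExteriorAlgebra ℂ L} (hw : w ∈ ⋀[ℂ]^q L) :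
    ∃ v ∈ ⋀[ℂ]^q (OppositeLie L), unop L v = w := by
  induction hw using ιMulti_induction with
  | hadd v w _ _ hv hw =>
    obtain ⟨v, hv, rfl⟩ := hv
    obtain ⟨w, hw, rfl⟩ := hw
    exact ⟨v + w, add_mem hv hw, map_add _ _ _⟩
  | hsmul c v _ hv =>
    obtain ⟨v, hv, rfl⟩ := hv
    exact ⟨c • v, Submodule.smul_mem _ _ hv, map_smul _ _ _⟩
  | hι y => exact ⟨_, ιMulti_mem q (fun i => toOpposite L (y i)), unop_ιMulti _⟩

theorem unop_bracketPart {q : ℕ} (y : Fin (q + 1) → OppositeLie L) :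
    unop L (bracketPart (OppositeLie L) q y : ExteriorAlgebra ℂ (OppositeLie L)) =
      -(bracketPart L q (fun i => (toOpposite L).symm (y i)) : ExteriorAlgebra ℂ L) := by
  cases q with
  | zero =>
    change unop L 0 = -0
    simp
  | succ q =>
    rw [bracketPart_succ_apply, bracketPart_succ_apply, AddSubmonoidClass.coe_finsetSum,
      AddSubmonoidClass.coe_finsetSum, map_sum, ← Finset.sum_neg_distrib]
    refine Finset.sum_congr rfl fun i _ => ?_
    rw [AddSubmonoidClass.coe_finsetSum, AddSubmonoidClass.coe_finsetSum, map_sum,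
      ← Finset.sum_neg_distrib]
    refine Finset.sum_congr rfl fun j _ => ?_
    rw [SetLike.val_smul, SetLike.val_smul, map_smul, ← smul_neg]
    congr 1
    rw [exteriorPower.ιMulti_apply_coe, exteriorPower.ιMulti_apply_coe, unop_ιMulti, ιMulti_succ,
      ιMulti_succ, ← neg_mul, ← map_neg]
    have h : (toOpposite L).symm ⁅y i.castSucc, y j.succ⁆ =
        -⁅(toOpposite L).symm (y i.castSucc), (toOpposite L).symm (y j.succ)⁆ :=
      (lie_skew _ _).symm
    simp only [Matrix.cons_val_zero, h]
    rfl

/-- The pairing `(η, ω) ↦ vol (ω ∧ η)`. -/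
noncomputable def wedgePairing (vol : ExteriorAlgebra ℂ L →ₗ[ℂ] ℂ) (p q : ℕ) :
    ⋀[ℂ]^q (OppositeLie L) →ₗ[ℂ] ⋀[ℂ]^p L →ₗ[ℂ] ℂ :=
  LinearMap.mk₂ ℂ (fun η ω => vol (ω * unop L η))
    (by intros; simp [mul_add]) (by intros; simp) (by intros; simp [add_mul]) (by intros; simp)

theorem wedgePairing_apply (vol : ExteriorAlgebra ℂ L →ₗ[ℂ] ℂ) {p q : ℕ}
    (η : ⋀[ℂ]^q (OppositeLie L)) (ω : ⋀[ℂ]^p L) :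
    wedgePairing vol p q η ω = vol (ω * unop L η) := rfl

/-- The pairing `(φ ⊗ η, e ⊗ ω) ↦ φ e * vol (ω ∧ η)`. -/
noncomputable def tensorPairing (E : Type*) [NormedAddCommGroup E] [NormedSpace ℂ E]
    (vol : ExteriorAlgebra ℂ L →ₗ[ℂ] ℂ) (p q : ℕ) :
    StrongDual ℂ E ⊗[ℂ] ⋀[ℂ]^q (OppositeLie L) →ₗ[ℂ] E ⊗[ℂ] ⋀[ℂ]^p L →ₗ[ℂ] ℂ :=
  (TensorProduct.map₂ (ContinuousLinearMap.coeLM ℂ) (wedgePairing vol p q)).compr₂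
    (TensorProduct.lid ℂ ℂ).toLinearMap

theorem tensorPairing_tmul (vol : ExteriorAlgebra ℂ L →ₗ[ℂ] ℂ) {p q : ℕ} (φ : StrongDual ℂ E)
    (η : ⋀[ℂ]^q (OppositeLie L)) (e : E) (ω : ⋀[ℂ]^p L) :
    tensorPairing E vol p q (φ ⊗ₜ η) (e ⊗ₜ ω) = φ e * wedgePairing vol p q η ω := rfl

theorem isSliceContinuous_tensorPairing [FiniteDimensional ℂ L]
    (vol : ExteriorAlgebra ℂ L →ₗ[ℂ] ℂ) {p q : ℕ}
    (u : StrongDual ℂ E ⊗[ℂ] ⋀[ℂ]^q (OppositeLie L)) :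
    IsSliceContinuous (tensorPairing E vol p q u) := by
  intro ω
  induction u using TensorProduct.induction_on with
  | zero => simpa using continuous_const
  | add u v hu hv =>
    simp only [map_add, LinearMap.add_apply]
    exact hu.add hv
  | tmul φ η =>
    simp only [tensorPairing_tmul]
    exact φ.continuous.mul continuous_const

variable [FiniteDimensional ℂ L]

variable (L) in
-- The top exterior power is a line; a coordinate on it is extended arbitrarily to the whole
-- algebra.
theorem exists_volume : ∃ vol : ExteriorAlgebra ℂ L →ₗ[ℂ] ℂ,
    ∀ w ∈ ⋀[ℂ]^(Module.finrank ℂ L) L, vol w = 0 → w = 0 := by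
  have h : Module.finrank ℂ (⋀[ℂ]^(Module.finrank ℂ L) L) = Module.finrank ℂ ℂ := by
    rw [exteriorPower.finrank_eq, Nat.choose_self, Module.finrank_self]
  let e := LinearEquiv.ofFinrankEq _ _ h
  obtain ⟨vol, hvol⟩ := LinearMap.exists_extend e.toLinearMap
  refine ⟨vol, fun w hw h0 => ?_⟩
  have : e ⟨w, hw⟩ = 0 := by
    rw [← h0]
    exact (DFunLike.congr_fun hvol ⟨w, hw⟩).symm
  exact congrArg Subtype.val ((LinearEquiv.map_eq_zero_iff e).1 this)

section Perfect

variable {vol : ExteriorAlgebra ℂ L →ₗ[ℂ] ℂ}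
  (hvol : ∀ w ∈ ⋀[ℂ]^(Module.finrank ℂ L) L, vol w = 0 → w = 0) {p q : ℕ}
  (hpq : p + q = Module.finrank ℂ L)

include hvol hpq

/-- Nondegeneracy of the wedge pairing gives injectivity, and symmetry of binomial coefficients
matches the dimensions. -/
theorem wedgePairing_flip_bijective :
    Function.Bijective (wedgePairing vol p q).flip := by
  have hinj : Function.Injective (wedgePairing vol p q).flip := by
    rw [injective_iff_map_eq_zero]
    intro ω hω
    refine Subtype.ext (eq_zero_of_mul_eq_zero hpq ω.2 fun w hw => ?_)
    obtain ⟨v, hv, rfl⟩ := exists_unop_eq hw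
    refine hvol _ ?_ (DFunLike.congr_fun hω ⟨v, hv⟩)
    rw [← hpq]
    exact SetLike.mul_mem_graded ω.2 (unop_mem hv)
  refine ⟨hinj, (LinearMap.injective_iff_surjective_of_finrank_eq_finrank ?_).1 hinj⟩
  rw [Subspace.dual_finrank_eq, exteriorPower.finrank_eq, exteriorPower.finrank_eq,
    ← (toOpposite L).finrank_eq]
  exact Nat.choose_symm_of_eq_add hpq.symm

theorem wedgePairing_bijective : Function.Bijective (wedgePairing vol p q) := by
  have hinj : Function.Injective (wedgePairing vol p q) := by
    rw [injective_iff_map_eq_zero]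
    intro η hη
    refine (Module.forall_dual_apply_eq_zero_iff ℂ η).1 fun g => ?_
    obtain ⟨ω, rfl⟩ := (wedgePairing_flip_bijective hvol hpq).2 g
    exact DFunLike.congr_fun hη ω
  refine ⟨hinj, (LinearMap.injective_iff_surjective_of_finrank_eq_finrank ?_).1 hinj⟩
  rw [Subspace.dual_finrank_eq, exteriorPower.finrank_eq, exteriorPower.finrank_eq,
    ← (toOpposite L).finrank_eq]
  exact (Nat.choose_symm_of_eq_add hpq.symm).symm

/-- Write `u` in a basis of the exterior power; testing against `e ⊗ ω`, with ω representing a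
coordinate functional, isolates one coefficient. -/
theorem tensorPairing_injective {u : StrongDual ℂ E ⊗[ℂ] ⋀[ℂ]^q (OppositeLie L)}
    (hu : tensorPairing E vol p q u = 0) : u = 0 := by
  set w := Module.finBasis ℂ (⋀[ℂ]^q (OppositeLie L)) with hw
  obtain ⟨a, rfl⟩ := (tensorPi (StrongDual ℂ E) (⋀[ℂ]^q (OppositeLie L))).symm.surjective u
  suffices h : a = 0 by rw [h, map_zero]
  funext i
  obtain ⟨ω, hω⟩ := (wedgePairing_flip_bijective hvol hpq).2 (w.coord i)
  have hω' : ∀ j, wedgePairing vol p q (w j) ω = w.coord i (w j) := fun j =>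
    DFunLike.congr_fun hω (w j)
  ext e
  have := DFunLike.congr_fun hu (e ⊗ₜ ω)
  rw [tensorPi_symm_apply, map_sum, LinearMap.sum_apply] at this
  simpa [tensorPairing_tmul, ← hw, hω', Finsupp.single_apply] using this

/-- The slices of `F` along a basis are elements of `E^*`; tensor them with the elements that
represent the coordinate functionals. -/
theorem tensorPairing_surjective {F : E ⊗[ℂ] ⋀[ℂ]^p L →ₗ[ℂ] ℂ} (hF : IsSliceContinuous F) :
    ∃ u, tensorPairing E vol p q u = F := by
  set v := Module.finBasis ℂ (⋀[ℂ]^p L) with hv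
  choose w hw using fun i => (wedgePairing_bijective hvol hpq).2 (v.coord i)
  let φ : Fin (Module.finrank ℂ (⋀[ℂ]^p L)) → StrongDual ℂ E := fun i =>
    ⟨F ∘ₗ (TensorProduct.mk ℂ E _).flip (v i), hF (v i)⟩
  refine ⟨∑ i, φ i ⊗ₜ w i, TensorProduct.ext' fun e ω => ?_⟩
  rw [map_sum, LinearMap.sum_apply]
  conv_rhs => rw [← v.sum_repr ω, TensorProduct.tmul_sum, map_sum]
  refine Finset.sum_congr rfl fun i _ => ?_
  rw [tensorPairing_tmul, hw, TensorProduct.tmul_smul, map_smul, smul_eq_mul, mul_comm]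
  rfl

end Perfect

/-- The functional on `L'` that corresponds to `f + traceAd L`. -/
noncomputable def shiftDual (f : Module.Dual ℂ L) : Module.Dual ℂ (OppositeLie L) :=
  (f + traceAd L) ∘ₗ (toOpposite L).symm.toLinearMap

/-- The heart of the proof. `contr_mul_eq` transposes the action part and `bracketOp_mul` the
bracket part; the trace term left by the latter is absorbed by the shift of f. -/
theorem tensorPairing_differential (vol : ExteriorAlgebra ℂ L →ₗ[ℂ] ℂ) (π : RightAction L E)
    (f : Module.Dual ℂ L) {p q : ℕ} (hpq : p + q + 1 = Module.finrank ℂ L)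
    (u : StrongDual ℂ E ⊗[ℂ] ⋀[ℂ]^(q + 1) (OppositeLie L)) :
    tensorPairing E vol p (q + 1) u ∘ₗ differential π f p = (-1 : ℂ) ^ p •
      tensorPairing E vol (p + 1) q (differential (dualAction π) (shiftDual f) q u) := by
  suffices h : (LinearMap.lcomp ℂ ℂ (differential π f p)) ∘ₗ tensorPairing E vol p (q + 1) =
      (-1 : ℂ) ^ p • (tensorPairing E vol (p + 1) q ∘ₗ
        differential (dualAction π) (shiftDual f) q) from DFunLike.congr_fun h u
  refine tensor_ιMulti_ext fun φ y => tensor_ιMulti_ext fun e x => ?_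
  set y' : Fin (q + 1) → L := fun i => (toOpposite L).symm (y i) with hy'
  set X := ExteriorAlgebra.ιMulti ℂ (p + 1) x with hX
  set Y := ExteriorAlgebra.ιMulti ℂ (q + 1) y' with hY
  -- Applying φ to the twisted action makes the whole action sum a contraction by this single
  -- functional.
  let g : Module.Dual ℂ L := φ.toLinearMap ∘ₗ (twistedOp π f).flip e
  have hg : ∀ z, g z = φ (π.op z e) - f z * φ e := fun z => by
    change φ (π.op z e - f z • e) = _
    rw [map_sub, map_smul, smul_eq_mul]
  have h1 : tensorPairing E vol p (q + 1) (φ ⊗ₜ exteriorPower.ιMulti ℂ (q + 1) y)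
      (differential π f p (e ⊗ₜ exteriorPower.ιMulti ℂ (p + 1) x)) =
      vol (contr g X * Y) + φ e * vol (bracketOp L X * Y) := by
    rw [differential_tmul, map_add, map_sum, tensorPairing_tmul, wedgePairing_apply,
      exteriorPower.ιMulti_apply_coe, unop_ιMulti, ← bracketOp_ιMulti, contr_ιMulti,
      Finset.sum_mul, map_sum]
    congr 1
    refine Finset.sum_congr rfl fun k _ => ?_
    rw [map_smul, tensorPairing_tmul, wedgePairing_apply, exteriorPower.ιMulti_apply_coe,
      exteriorPower.ιMulti_apply_coe, unop_ιMulti, hg, smul_mul_assoc, smul_mul_assoc, map_smul,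
      map_smul, map_sub, map_smul]
    rfl
  have h2 : tensorPairing E vol (p + 1) q (differential (dualAction π) (shiftDual f) q
      (φ ⊗ₜ exteriorPower.ιMulti ℂ (q + 1) y)) (e ⊗ₜ exteriorPower.ιMulti ℂ (p + 1) x) =
      vol (X * contr (g - φ e • traceAd L) Y) - φ e * vol (X * bracketOp L Y) := by
    rw [differential_tmul, map_add, LinearMap.add_apply, map_sum, LinearMap.sum_apply,
      tensorPairing_tmul, wedgePairing_apply, exteriorPower.ιMulti_apply_coe, unop_bracketPart,
      ← bracketOp_ιMulti, contr_ιMulti, Finset.mul_sum, map_sum, sub_eq_add_neg, ← mul_neg,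
      mul_neg (ExteriorAlgebra.ιMulti ℂ (p + 1) x), map_neg vol]
    congr 1
    refine Finset.sum_congr rfl fun k _ => ?_
    rw [map_smul, LinearMap.smul_apply, tensorPairing_tmul, wedgePairing_apply,
      exteriorPower.ιMulti_apply_coe, exteriorPower.ιMulti_apply_coe, unop_ιMulti, mul_smul_comm,
      mul_smul_comm, map_smul, map_smul]
    congr 1
    rw [smul_eq_mul]
    congr 1
    have h3 : (dualAction π).op (y k) φ e = φ (π.op (y' k) e) := rfl
    have h4 : shiftDual f (y k) = f (y' k) + traceAd L (y' k) := rfl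
    rw [sub_apply, h3, smul_apply, h4,
      LinearMap.sub_apply, hg, LinearMap.smul_apply, smul_eq_mul, smul_eq_mul]
    ring
  have hXm : X ∈ ⋀[ℂ]^(p + 1) L := ιMulti_mem _ _
  have hYm : Y ∈ ⋀[ℂ]^(q + 1) L := ιMulti_mem _ _
  change tensorPairing E vol p (q + 1) (φ ⊗ₜ exteriorPower.ιMulti ℂ (q + 1) y)
      (differential π f p (e ⊗ₜ exteriorPower.ιMulti ℂ (p + 1) x)) = (-1 : ℂ) ^ p *
    tensorPairing E vol (p + 1) q (differential (dualAction π) (shiftDual f) q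
      (φ ⊗ₜ exteriorPower.ιMulti ℂ (q + 1) y)) (e ⊗ₜ exteriorPower.ιMulti ℂ (p + 1) x)
  rw [h1, h2, bracketOp_mul hpq hXm hYm, contr_mul_eq g (by omega) hXm hYm]
  simp only [map_sub, map_neg, map_smul, LinearMap.sub_apply, LinearMap.smul_apply, mul_sub,
    mul_neg, mul_smul_comm, smul_eq_mul, pow_succ]
  ring

/-- Duality: exactness for `f` on `E` is exactness for the shifted functional on the dual. -/
theorem exact_iff_exact_dualAction [CompleteSpace E] (π : RightAction L E) {f : Module.Dual ℂ L}
    (hf : f ∈ (derivedSubspace L).dualAnnihilator) :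
    (∀ p, ∀ u ∈ cycles π f p, ∃ v, differential π f p v = u) ↔
    (∀ q, ∀ u ∈ cycles (dualAction π) (shiftDual f) q,
      ∃ v, differential (dualAction π) (shiftDual f) q v = u) := by
  obtain ⟨vol, hvol⟩ := exists_volume L
  have hsub : ∀ p, Module.finrank ℂ L < p → Subsingleton (E ⊗[ℂ] ⋀[ℂ]^p L) := by
    intro p hp
    have : Subsingleton (⋀[ℂ]^p L) :=
      ⟨fun a b => Subtype.ext (by rw [eq_zero_of_mem_of_finrank_lt hp a.2,
        eq_zero_of_mem_of_finrank_lt hp b.2])⟩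
    infer_instance
  have hsub' : ∀ q, Module.finrank ℂ L < q →
      Subsingleton (StrongDual ℂ E ⊗[ℂ] ⋀[ℂ]^q (OppositeLie L)) := by
    intro p hp
    rw [(toOpposite L).finrank_eq] at hp
    have : Subsingleton (⋀[ℂ]^p (OppositeLie L)) :=
      ⟨fun a b => Subtype.ext (by rw [eq_zero_of_mem_of_finrank_lt hp a.2,
        eq_zero_of_mem_of_finrank_lt hp b.2])⟩
    infer_instance
  have hs : ∀ p : ℕ, ((-1 : ℂ) ^ p) ≠ 0 := fun p => pow_ne_zero _ (by norm_num)
  -- Cocycles of the dual complex are cycles for the dual action in complementary degree. For `q =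
  -- 0` both conditions are vacuous, since `⋀^(p+1) L` is zero.
  have hker : ∀ p q, p + q = Module.finrank ℂ L →
      ∀ u, tensorPairing E vol p q u ∘ₗ differential π f p = 0 ↔
        u ∈ cycles (dualAction π) (shiftDual f) q := by
    rintro p (_ | q) hpq u
    · have := hsub (p + 1) (by omega)
      exact ⟨fun _ => trivial, fun _ => LinearMap.ext fun x => by
        rw [Subsingleton.elim x 0, map_zero, map_zero]⟩
    · rw [tensorPairing_differential vol π f (by omega), smul_eq_zero_iff_right (hs p)]
      exact ⟨fun h => tensorPairing_injective hvol (by omega) h, fun h => by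
        rw [LinearMap.mem_ker.1 h, map_zero]⟩
  rw [exact_iff_dual_exact_differential π hf]
  constructor
  · rintro ⟨h0, h1⟩ q u hu
    rcases lt_or_ge (Module.finrank ℂ L) q with hq | hq
    · have := hsub' q hq
      exact ⟨0, Subsingleton.elim _ _⟩
    obtain ⟨p, hpq⟩ := Nat.exists_eq_add_of_le' hq
    have hF := (hker p q hpq.symm u).2 hu
    cases p with
    | zero =>
      have := h0 _ (isSliceContinuous_tensorPairing vol u) hF
      exact ⟨0, by rw [tensorPairing_injective hvol hpq.symm this, map_zero]⟩
    | succ p =>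
      obtain ⟨G, hG, hGd⟩ := h1 p _ (isSliceContinuous_tensorPairing vol u) hF
      obtain ⟨v, rfl⟩ := tensorPairing_surjective hvol (q := q + 1) (by omega) hG
      rw [tensorPairing_differential vol π f (by omega), ← map_smul, ← sub_eq_zero, ← map_sub,
        ← map_smul] at hGd
      exact ⟨_, sub_eq_zero.1 (tensorPairing_injective hvol hpq.symm hGd)⟩
  · intro h
    refine ⟨fun F hF hF0 => ?_, fun p F hF hF0 => ?_⟩
    · obtain ⟨u, rfl⟩ := tensorPairing_surjective hvol (q := Module.finrank ℂ L) (by omega) hF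
      obtain ⟨v, rfl⟩ := h _ u ((hker _ _ (by omega) u).1 hF0)
      have := hsub' (Module.finrank ℂ L + 1) (by omega)
      rw [Subsingleton.elim v 0, map_zero, map_zero]
    · rcases lt_or_ge (Module.finrank ℂ L) (p + 1) with hp | hp
      · have := hsub (p + 1) hp
        refine ⟨0, fun _ => continuous_const, LinearMap.ext fun x => ?_⟩
        rw [Subsingleton.elim x 0, map_zero, map_zero]
      obtain ⟨q, hpq⟩ := Nat.exists_eq_add_of_le hp
      obtain ⟨u, rfl⟩ := tensorPairing_surjective hvol hpq.symm hF
      obtain ⟨v, rfl⟩ := h _ u ((hker _ _ hpq.symm u).1 hF0)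
      refine ⟨(-1 : ℂ) ^ p • tensorPairing E vol p (q + 1) v, fun ω => ?_, ?_⟩
      · exact (isSliceContinuous_tensorPairing vol v ω).const_smul ((-1 : ℂ) ^ p)
      · rw [LinearMap.smul_comp, tensorPairing_differential vol π f (by omega), smul_smul,
          ← mul_pow]
        simp

end Duality

/-! ### Adapted bases, traces and the shift of the spectrum. -/

section AdaptedBasis

variable {L : Type*} [LieRing L] [LieAlgebra ℂ L]

/-- Lie's theorem: a module over a solvable Lie algebra has a triangular basis. -/
theorem exists_triangular_basis [LieAlgebra.IsSolvable L] (n : ℕ) (V : Type*)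
    [AddCommGroup V] [Module ℂ V] [LieRingModule L V] [LieModule ℂ L V] [FiniteDimensional ℂ V]
    (hn : Module.finrank ℂ V = n) : ∃ b : Module.Basis (Fin n) ℂ V,
      ∀ (i : Fin n) (x : L), ⁅x, b i⁆ ∈ Submodule.span ℂ (b '' {h | h ≤ i}) := by
  induction n generalizing V with
  | zero => exact ⟨Module.finBasisOfFinrankEq ℂ V hn, fun i => i.elim0⟩
  | succ n ih =>
    have : Nontrivial V := Module.nontrivial_of_finrank_pos (R := ℂ) (by omega)
    -- A common eigenvector in the dual module has an invariant hyperplane as kernel. The induction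
    -- runs on it, and a vector outside is appended last.
    obtain ⟨χ, hχ⟩ := LieModule.exists_nontrivial_weightSpace_of_isSolvable ℂ L (V →ₗ[ℂ] ℂ)
    obtain ⟨⟨φ, hφ⟩, hφ0⟩ := exists_ne (0 : LieModule.weightSpace (V →ₗ[ℂ] ℂ) χ)
    have hφ0 : φ ≠ 0 := fun h => hφ0 (Subtype.ext h)
    have hφ : ∀ (x : L) v, φ ⁅x, v⁆ = -(χ x * φ v) := by
      intro x v
      have := DFunLike.congr_fun ((LieModule.mem_weightSpace _ _).1 hφ x) v
      rw [Module.Dual.lie_apply, LinearMap.smul_apply, smul_eq_mul] at this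
      rw [← this, neg_neg]
    let N : LieSubmodule ℂ L V :=
      { toSubmodule := LinearMap.ker φ
        lie_mem := fun {x v} hv => by
          change φ ⁅x, v⁆ = 0
          rw [hφ, show φ v = 0 from hv, mul_zero, neg_zero] }
    have hN : Module.finrank ℂ N = n := by
      have := Module.Dual.finrank_ker_add_one_of_ne_zero hφ0
      change Module.finrank ℂ (LinearMap.ker φ) = n
      omega
    obtain ⟨c, hc⟩ := ih N hN
    obtain ⟨y, hy⟩ : ∃ y, φ y ≠ 0 := by
      by_contra! h
      exact hφ0 (LinearMap.ext h)
    let b : Module.Basis (Fin (n + 1)) ℂ V := Module.Basis.mkFinSnoc (N := LinearMap.ker φ) c y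
      (fun t x hx h => by
        have := congrArg φ h
        rw [map_add, map_smul, show φ x = 0 from hx, add_zero, map_zero, smul_eq_mul] at this
        exact (mul_eq_zero.1 this).resolve_right hy)
      (fun z => ⟨-(φ z / φ y), by
        change φ _ = 0
        rw [map_add, map_smul, smul_eq_mul]
        field_simp
        ring⟩)
    have hb : (b : Fin (n + 1) → V) = Fin.snoc (fun j => (c j : V)) y :=
      Module.Basis.coe_mkFinSnoc _ _ _ _
    refine ⟨b, fun i x => ?_⟩
    induction i using Fin.lastCases with
    | last =>
      have : {h : Fin (n + 1) | h ≤ Fin.last n} = Set.univ :=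
        Set.eq_univ_of_forall fun h => Fin.le_last h
      rw [this, Set.image_univ, b.span_eq]
      exact Submodule.mem_top
    | cast j =>
      have h1 : ⁅x, b j.castSucc⁆ = (N.incl : N →ₗ[ℂ] V) ⁅x, c j⁆ := by
        rw [hb, Fin.snoc_castSucc]
        rfl
      have h2 := Submodule.mem_map_of_mem (f := (N.incl : N →ₗ[ℂ] V)) (hc j x)
      rw [Submodule.map_span, ← Set.image_comp] at h2
      rw [h1]
      refine Submodule.span_mono ?_ h2
      rintro _ ⟨k, hk, rfl⟩
      refine ⟨k.castSucc, Fin.castSucc_le_castSucc_iff.2 hk, ?_⟩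
      rw [hb, Fin.snoc_castSucc]
      rfl

theorem exists_triangular_basis_submodule [LieAlgebra.IsSolvable L] {V : Type*}
    [AddCommGroup V] [Module ℂ V] [LieRingModule L V] [LieModule ℂ L V] [FiniteDimensional ℂ V]
    (N : LieSubmodule ℂ L V) :
    ∃ c : Module.Basis (Fin (Module.finrank ℂ N.toSubmodule)) ℂ N.toSubmodule,
      ∀ i (x : L), ⁅x, (c i : V)⁆ ∈ Submodule.span ℂ ((fun j => (c j : V)) '' {h | h ≤ i}) := by
  obtain ⟨c, hc⟩ := exists_triangular_basis (L := L) _ N rfl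
  refine ⟨c, fun i x => ?_⟩
  have h := Submodule.mem_map_of_mem (f := (N.incl : N →ₗ[ℂ] V)) (hc i x)
  rw [Submodule.map_span, ← Set.image_comp] at h
  exact h

/-- Take a triangular basis of L² and complete it by any complement. Past index `k` triangularity is
automatic, as every bracket lies in the span of the first `k` vectors. -/
theorem exists_isAdaptedBasis [LieAlgebra.IsSolvable L] [FiniteDimensional ℂ L] :
    ∃ b : Module.Basis (Fin (Module.finrank ℂ L)) ℂ L, IsAdaptedBasis b := by
  set k := Module.finrank ℂ (derivedSubspace L) with hk
  obtain ⟨c, hc⟩ : ∃ c : Module.Basis (Fin k) ℂ (derivedSubspace L), ∀ i (x : L),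
      ⁅x, (c i : L)⁆ ∈ Submodule.span ℂ ((fun j => (c j : L)) '' {h | h ≤ i}) :=
    exists_triangular_basis_submodule _
  obtain ⟨C, hC⟩ := Submodule.exists_isCompl (derivedSubspace L)
  have hdim := Submodule.finrank_add_eq_of_isCompl hC
  let b : Module.Basis (Fin (Module.finrank ℂ L)) ℂ L :=
    (((c.prod (Module.finBasis ℂ C)).map (Submodule.prodEquivOfIsCompl _ _ hC)).reindex
      finSumFinEquiv).reindex (finCongr hdim)
  have hb : ∀ (i : Fin (Module.finrank ℂ L)) (hi : (i : ℕ) < k), b i = c ⟨i, hi⟩ := by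
    intro i hi
    have : (finCongr hdim).symm i = finSumFinEquiv (Sum.inl ⟨i, hi⟩) := rfl
    simp only [b, Module.Basis.reindex_apply, this, Equiv.symm_apply_apply, Module.Basis.map_apply]
    simp
  have hkn : k ≤ Module.finrank ℂ L := Submodule.finrank_le _
  have hspan : Submodule.span ℂ (b '' {h | (h : ℕ) < k}) = derivedSubspace L := by
    have : b '' {h | (h : ℕ) < k} = (derivedSubspace L).subtype '' Set.range c := by
      ext x
      constructor
      · rintro ⟨i, hi, rfl⟩
        exact ⟨_, ⟨⟨i, hi⟩, rfl⟩, (hb i hi).symm⟩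
      · rintro ⟨_, ⟨i, rfl⟩, rfl⟩
        exact ⟨⟨i, i.2.trans_le hkn⟩, i.2, hb _ i.2⟩
    rw [this, ← Submodule.map_span, c.span_eq, Submodule.map_subtype_top]
  refine ⟨b, fun i j _ => ?_, hspan⟩
  rcases lt_or_ge (i : ℕ) k with hi | hi
  · have h2 := hc ⟨i, hi⟩ (b j)
    rw [← hb i hi] at h2
    refine Submodule.span_mono ?_ h2
    rintro _ ⟨h, hh, rfl⟩
    exact ⟨⟨h, h.2.trans_le hkn⟩, hh, hb _ h.2⟩
  · have h1 : ⁅b j, b i⁆ ∈ derivedSubspace L :=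
      LieSubmodule.lie_mem_lie (LieSubmodule.mem_top _) (LieSubmodule.mem_top _)
    rw [← hspan] at h1
    refine Submodule.span_mono (Set.image_mono fun h hh => ?_) h1
    exact (lt_of_lt_of_le hh hi).le

variable [FiniteDimensional ℂ L]

/-- The ideal contains x_i, so ad x_i maps all of L into it, and restricting to a subspace
containing the image keeps the trace. -/
theorem traceTheta_eq_traceAd {n : ℕ} (b : Module.Basis (Fin n) ℂ L) (i : Fin n) :
    traceTheta b i = traceAd L (b i) := by
  have hmem : b i ∈ flagIdeal b i := LieSubmodule.subset_lieSpan ⟨i, le_refl i, rfl⟩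
  refine LinearMap.trace_restrict_eq_of_forall_mem (flagIdeal b i).toSubmodule
    (LieModule.toEnd ℂ L L (b i)) (fun y => ?_)
  exact lie_mem_left ℂ L (flagIdeal b i) _ _ hmem

omit [FiniteDimensional ℂ L] in
-- ad ⁅y, z⁆ is a commutator of endomorphisms, so its trace is zero.
theorem traceAd_mem_dualAnnihilator : traceAd L ∈ (derivedSubspace L).dualAnnihilator := by
  rw [Submodule.mem_dualAnnihilator]
  intro x hx
  rw [derivedSubspace, LieSubmodule.mem_toSubmodule, ← LieSubmodule.mem_toSubmodule,
    LieSubmodule.lieIdeal_oper_eq_linear_span'] at hx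
  induction hx using Submodule.span_induction with
  | mem x hx =>
    obtain ⟨y, -, z, -, rfl⟩ := hx
    change LinearMap.trace ℂ L (LieModule.toEnd ℂ L L ⁅y, z⁆) = 0
    have : LieModule.toEnd ℂ L L ⁅y, z⁆ = LieModule.toEnd ℂ L L y * LieModule.toEnd ℂ L L z -
        LieModule.toEnd ℂ L L z * LieModule.toEnd ℂ L L y := LinearMap.ext fun v => lie_lie y z v
    rw [this, map_sub, LinearMap.trace_mul_comm, sub_self]
  | zero => exact map_zero _
  | add x y _ _ hx hy => rw [map_add, hx, hy, add_zero]
  | smul c x _ hx => rw [map_smul, hx, smul_zero]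

omit [FiniteDimensional ℂ L] in
theorem shiftDual_mem_dualAnnihilator {f : Module.Dual ℂ L}
    (hf : f ∈ (derivedSubspace L).dualAnnihilator) :
    shiftDual f ∈ (derivedSubspace (OppositeLie L)).dualAnnihilator := by
  rw [Submodule.mem_dualAnnihilator]
  intro x hx
  rw [derivedSubspace, LieSubmodule.mem_toSubmodule, ← LieSubmodule.mem_toSubmodule,
    LieSubmodule.lieIdeal_oper_eq_linear_span'] at hx
  induction hx using Submodule.span_induction with
  | mem x hx =>
    obtain ⟨y, -, z, -, rfl⟩ := hx
    exact apply_lie_eq_zero (add_mem hf traceAd_mem_dualAnnihilator)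
      ((toOpposite L).symm z) ((toOpposite L).symm y)
  | zero => exact map_zero _
  | add x y _ _ hx hy => rw [map_add, hx, hy, add_zero]
  | smul c x _ hx => rw [map_smul, hx, smul_zero]

omit [FiniteDimensional ℂ L] in
theorem mem_dualAnnihilator_of_shiftDual {f : Module.Dual ℂ L}
    (hf : shiftDual f ∈ (derivedSubspace (OppositeLie L)).dualAnnihilator) :
    f ∈ (derivedSubspace L).dualAnnihilator := by
  have h1 : f + traceAd L ∈ (derivedSubspace L).dualAnnihilator := by
    rw [Submodule.mem_dualAnnihilator]
    intro x hx
    rw [derivedSubspace, LieSubmodule.mem_toSubmodule, ← LieSubmodule.mem_toSubmodule,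
      LieSubmodule.lieIdeal_oper_eq_linear_span'] at hx
    induction hx using Submodule.span_induction with
    | mem x hx =>
      obtain ⟨y, -, z, -, rfl⟩ := hx
      exact apply_lie_eq_zero hf (toOpposite L z) (toOpposite L y)
    | zero => exact map_zero _
    | add x y _ _ hx hy => rw [map_add, hx, hy, add_zero]
    | smul c x _ hx => rw [map_smul, hx, smul_zero]
  simpa using sub_mem h1 traceAd_mem_dualAnnihilator

omit [FiniteDimensional ℂ L] in
theorem shiftDual_surjective : Function.Surjective (shiftDual : Module.Dual ℂ L → _) := by
  intro g
  refine ⟨g ∘ₗ (toOpposite L).toLinearMap - traceAd L, ?_⟩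
  refine LinearMap.ext fun x => ?_
  simp [shiftDual]

theorem mem_Sp_iff_shiftDual_mem_Sp {E : Type*} [NormedAddCommGroup E] [NormedSpace ℂ E]
    [CompleteSpace E] (π : RightAction L E) (f : Module.Dual ℂ L) :
    f ∈ Sp π ↔ shiftDual f ∈ Sp (dualAction π) := by
  constructor
  · rintro ⟨hf, h⟩
    refine ⟨shiftDual_mem_dualAnnihilator hf, ?_⟩
    rwa [exists_nontrivial_homology_iff, ← exact_iff_exact_dualAction π hf,
      ← exists_nontrivial_homology_iff]
  · rintro ⟨hf, h⟩
    have hf := mem_dualAnnihilator_of_shiftDual hf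
    refine ⟨hf, ?_⟩
    rwa [exists_nontrivial_homology_iff, exact_iff_exact_dualAction π hf,
      ← exists_nontrivial_homology_iff]

end AdaptedBasis

end SolvableSpectrum

/-! ### The statement in coordinates. -/

theorem proposition3p6
    {L : Type*} [LieRing L] [LieAlgebra ℂ L] [FiniteDimensional ℂ L] [LieAlgebra.IsSolvable L]
    {E : Type*} [NormedAddCommGroup E] [NormedSpace ℂ E] [CompleteSpace E]
    (π : SolvableSpectrum.RightAction L E) (n k : ℕ) (hn : n = Module.finrank ℂ L)
    (hk : k = Module.finrank ℂ (SolvableSpectrum.derivedSubspace L)) :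
    (∃ b : Module.Basis (Fin n) ℂ L, SolvableSpectrum.IsAdaptedBasis b) ∧
    ∀ b : Module.Basis (Fin n) ℂ L, SolvableSpectrum.IsAdaptedBasis b →
      (∀ i : Fin n, (i : ℕ) < k → SolvableSpectrum.traceTheta b i = 0) ∧
      (fun v : Fin n → ℂ =>
          v + fun i : Fin n => if (i : ℕ) < k then 0 else SolvableSpectrum.traceTheta b i) ''
        SolvableSpectrum.spCoordinates b π =
      SolvableSpectrum.spCoordinates (b.map (SolvableSpectrum.toOpposite L))
        (SolvableSpectrum.dualAction π) := by
  subst hn hk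
  refine ⟨SolvableSpectrum.exists_isAdaptedBasis, fun b hb => ?_⟩
  have htrace : ∀ i : Fin (Module.finrank ℂ L),
      (i : ℕ) < Module.finrank ℂ (SolvableSpectrum.derivedSubspace L) →
      SolvableSpectrum.traceTheta b i = 0 := by
    intro i hi
    rw [SolvableSpectrum.traceTheta_eq_traceAd]
    refine (Submodule.mem_dualAnnihilator _).1
      SolvableSpectrum.traceAd_mem_dualAnnihilator _ ?_
    rw [← hb.span_derived]
    exact Submodule.subset_span ⟨i, hi, rfl⟩
  refine ⟨htrace, ?_⟩
  have hcoord : ∀ f : Module.Dual ℂ L,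
      (b.map (SolvableSpectrum.toOpposite L)).dualBasis.equivFun (SolvableSpectrum.shiftDual f) =
        b.dualBasis.equivFun f + fun i : Fin (Module.finrank ℂ L) =>
          if (i : ℕ) < Module.finrank ℂ (SolvableSpectrum.derivedSubspace L) then 0
          else SolvableSpectrum.traceTheta b i := by
    intro f
    funext i
    -- The zeros in the first `k` places are the actual traces, so the shift is `traceAd` in every
    -- coordinate.
    have hi : (if (i : ℕ) < Module.finrank ℂ (SolvableSpectrum.derivedSubspace L) then 0
          else SolvableSpectrum.traceTheta b i) = SolvableSpectrum.traceAd L (b i) := by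
      rw [← SolvableSpectrum.traceTheta_eq_traceAd]
      split_ifs with h
      · exact (htrace i h).symm
      · rfl
    rw [Pi.add_apply, hi]
    simp [SolvableSpectrum.shiftDual]
  ext v
  constructor
  · rintro ⟨_, ⟨f, hf, rfl⟩, rfl⟩
    exact ⟨_, (SolvableSpectrum.mem_Sp_iff_shiftDual_mem_Sp π f).1 hf, hcoord f⟩
  · rintro ⟨g, hg, rfl⟩
    obtain ⟨f, rfl⟩ := SolvableSpectrum.shiftDual_surjective g
    exact ⟨_, ⟨f, (SolvableSpectrum.mem_Sp_iff_shiftDual_mem_Sp π f).2 hg, rfl⟩, (hcoord f).symm⟩
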